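/- Let $\Theta\subset\mathbb R^p$ be open and let $\{f(\cdot\mid\theta):\theta\in\Theta\}$ be a jointly measurable family of probability densities on $\mathbb R$ (with respect to Lebesgue measure), with distribution functions $F(\cdot\mid\theta)$; outside $\Theta$ all quantities are given arbitrary measurable extensions. Write $s(x,\theta)=\partial_\theta\ln f(x\mid\theta)$ for the score and $$\tau(x,\theta)=\bigl[\cos\{2\pi F(x\mid\theta)\},\ \sin\{2\pi F(x\mid\theta)\}\bigr]^\top .$$ For a map $r(x,\theta)\in\mathbb R^p$ and $X\sim F(\cdot\mid\theta)$ put $$R_\theta=\mathbb E\{r(X,\theta)r(X,\theta)^\top\},\quad J_\theta=\mathbb E\{\tau(X,\theta)r(X,\theta)^\top\},\quad G_\theta=\mathbb E\{\tau(X,\theta)s(X,\theta)^\top\},$$ $$\Sigma_\theta=\tfrac12 I_2-G_\theta R_\theta^{-1}J_\theta^\top-J_\theta R_\theta^{-1}G_\theta^\top+G_\theta R_\theta^{-1}G_\theta^\top .$$ Let $\theta_0\in\Theta$ and assume the following regularity conditions: for $F(\cdot\mid\theta_0)$-almost every $x$ the function $\theta\mapsto\ln f(x\mid\theta)$ is differentiable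 at $\theta_0$; $s(\cdot,\theta_0)$ is integrable under $F(\cdot\mid\theta_0)$; the densities are differentiable in mean at $\theta_0$, i.e. $$\int_{\mathbb R}\bigl|f(x\mid\theta)-f(x\mid\theta_0)-(\theta-\theta_0)^\top s(x,\theta_0)f(x\mid\theta_0)\bigr|\,dx=o(\|\theta-\theta_0\|)\qquad(\theta\to\theta_0);$$ and $\theta\mapsto\Sigma_\theta$ is Borel measurable, is continuous at $\theta_0$, and $\Sigma_{\theta_0}$ is nonsingular. Suppose that $\mathcal H_0$ holds: $X_1,X_2,\dots$ are independent with common distribution function $F(\cdot\mid\theta_0)$. Let $\hat\theta_n=\hat\theta_n(X_1,\dots,X_n)$ be measurable $\mathbb R^p$-valued estimators with the linear representation $$\sqrt n(\hat\theta_n-\theta_0)-R_{\theta_0}^{-1}\frac1{\sqrt n}\sum_{i=1}^n r(X_i,\theta_0)\ \xrightarrow{\ \mathbb P\ }\ 0,$$ where, for $X\sim F(\cdot\mid\theta_0)$, $r(X,\theta_0)$ is square integrable, $\mathbb E\{r(X,\theta_0)\}=0$, and $R_{\theta_0}$ is positive definite. With $\bar\tau_n(\theta)=\frac1n\sum_{i=1}^n\tau(X_i,\theta)$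 and $T_n(\theta)=n\,\bar\tau_n(\theta)^\top\Sigma_\theta^{-1}\bar\tau_n(\theta)$, one has, as $n\to\infty$, the convergences in distribution $$\sqrt n\,\Sigma_{\hat\theta_n}^{-1/2}\,\bar\tau_n(\hat\theta_n)\rightsquigarrow\mathcal N_2(0,I_2),\qquad T_n(\hat\theta_n)\rightsquigarrow\chi^2_2 ,$$ where $\Sigma_\theta^{-1/2}$ is the inverse of the positive semidefinite square root of $\Sigma_\theta$. (On the event that $\Sigma_{\hat\theta_n}$ is not positive definite, whose probability tends to $0$, these expressions are given arbitrary measurable values.) -/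

import Mathlib

open MeasureTheory ProbabilityTheory Filter Topology Asymptotics
open scoped Matrix MatrixOrder

namespace TrigGOF

/-- Column vectors of `ℝᵖ` with the Euclidean norm. -/
abbrev Vec (p : ℕ) : Type := EuclideanSpace ℝ (Fin p)

variable {p : ℕ}

/-- The distribution on `ℝ` with Lebesgue density `f(· | θ)`. -/
noncomputable def law (f : Vec p → ℝ → ℝ) (θ : Vec p) : Measure ℝ :=
  volume.withDensity (fun x => ENNReal.ofReal (f θ x))

/-- The distribution function `F(x | θ) = P_θ(X ≤ x)`. -/
noncomputable def distFun (f : Vec p → ℝ → ℝ) (θ : Vec p) (x : ℝ) : ℝ :=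
  (law f θ).real (Set.Iic x)

/-- The kernel `τ(x, θ) = [cos(2πF(x | θ)), sin(2πF(x | θ))]ᵀ`. -/
noncomputable def tau (f : Vec p → ℝ → ℝ) (θ : Vec p) (x : ℝ) : Vec 2 :=
  !₂[Real.cos (2 * Real.pi * distFun f θ x), Real.sin (2 * Real.pi * distFun f θ x)]

/-- The score function `s(x, θ) = ∂_θ ln f(x | θ)`. -/
noncomputable def score (f : Vec p → ℝ → ℝ) (θ : Vec p) (x : ℝ) : Vec p :=
  gradient (fun η : Vec p => Real.log (f η x)) θ

/-- `R_θ = E{r(X, θ) r(X, θ)ᵀ}` for `X ∼ F(· | θ)`. -/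
noncomputable def matR (f : Vec p → ℝ → ℝ) (r : Vec p → ℝ → Vec p) (θ : Vec p) :
    Matrix (Fin p) (Fin p) ℝ :=
  Matrix.of fun i j => ∫ x, r θ x i * r θ x j ∂(law f θ)

/-- `J_θ = E{τ(X, θ) r(X, θ)ᵀ}` for `X ∼ F(· | θ)`. -/
noncomputable def matJ (f : Vec p → ℝ → ℝ) (r : Vec p → ℝ → Vec p) (θ : Vec p) :
    Matrix (Fin 2) (Fin p) ℝ :=
  Matrix.of fun i j => ∫ x, tau f θ x i * r θ x j ∂(law f θ)

/-- `G_θ = E{τ(X, θ) s(X, θ)ᵀ}` for `X ∼ F(· | θ)`. -/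
noncomputable def matG (f : Vec p → ℝ → ℝ) (θ : Vec p) : Matrix (Fin 2) (Fin p) ℝ :=
  Matrix.of fun i j => ∫ x, tau f θ x i * score f θ x j ∂(law f θ)

/-- `Σ_θ = ½ I₂ - G R⁻¹ Jᵀ - J R⁻¹ Gᵀ + G R⁻¹ Gᵀ`, all matrices taken at `θ`. -/
noncomputable def sigma (f : Vec p → ℝ → ℝ) (r : Vec p → ℝ → Vec p) (θ : Vec p) :
    Matrix (Fin 2) (Fin 2) ℝ :=
  (1 / 2 : ℝ) • (1 : Matrix (Fin 2) (Fin 2) ℝ)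
    - matG f θ * (matR f r θ)⁻¹ * (matJ f r θ)ᵀ
    - matJ f r θ * (matR f r θ)⁻¹ * (matG f θ)ᵀ
    + matG f θ * (matR f r θ)⁻¹ * (matG f θ)ᵀ

/-- The vector of sample trigonometric moments
`τ̄ₙ(θ) = (1/n) ∑ᵢ τ(xᵢ, θ) = [Cₙ(θ), Sₙ(θ)]ᵀ`. -/
noncomputable def tauBar (f : Vec p → ℝ → ℝ) {n : ℕ} (x : Fin n → ℝ) (θ : Vec p) : Vec 2 :=
  (n : ℝ)⁻¹ • ∑ i, tau f θ (x i)

/-- `A^{-1/2}`, the inverse of the positive semidefinite square root; meaningful for positive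
definite `A`. -/
noncomputable def invSqrt (A : Matrix (Fin 2) (Fin 2) ℝ) : Matrix (Fin 2) (Fin 2) ℝ :=
  (CFC.sqrt A)⁻¹

/-- The normalized vector `√n Σ_θ^{-1/2} τ̄ₙ(θ)`. -/
noncomputable def normalized (f : Vec p → ℝ → ℝ) (r : Vec p → ℝ → Vec p) {n : ℕ}
    (x : Fin n → ℝ) (θ : Vec p) : Vec 2 :=
  √(n : ℝ) • Matrix.toEuclideanCLM (𝕜 := ℝ) (invSqrt (sigma f r θ)) (tauBar f x θ)

/-- The test statistic `Tₙ(θ) = n τ̄ₙ(θ)ᵀ Σ_θ⁻¹ τ̄ₙ(θ)`. -/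
noncomputable def testStat (f : Vec p → ℝ → ℝ) (r : Vec p → ℝ → Vec p) {n : ℕ}
    (x : Fin n → ℝ) (θ : Vec p) : ℝ :=
  n * ((tauBar f x θ).ofLp ⬝ᵥ ((sigma f r θ)⁻¹ *ᵥ (tauBar f x θ).ofLp))

/-- The chi-squared distribution with `k` degrees of freedom: the law of the sum of the squares
of `k` independent standard normal variables. -/
noncomputable def chiSquared (k : ℕ) : Measure ℝ :=
  (Measure.pi fun _ : Fin k => gaussianReal 0 1).map fun z => ∑ i, z i ^ 2

instance isProbabilityMeasure_chiSquared (k : ℕ) : IsProbabilityMeasure (chiSquared k) :=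
  Measure.isProbabilityMeasure_map (Measurable.aemeasurable (by fun_prop))

/-- `f(· | θ)`, `θ ∈ Θ`, is a jointly measurable family of probability densities on `ℝ`. -/
structure IsDensityFamily (f : Vec p → ℝ → ℝ) (Θ : Set (Vec p)) : Prop where
  measurable : Measurable (Function.uncurry f)
  nonneg : ∀ θ ∈ Θ, ∀ x, 0 ≤ f θ x
  integral_eq_one : ∀ θ ∈ Θ, ∫ x, f θ x = 1

/-- Regularity of the model at `θ₀`: the score exists almost surely and is integrable under
`F(· | θ₀)`, and `θ ↦ f(· | θ)` is differentiable in mean at `θ₀` with derivative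
`s(·, θ₀) f(· | θ₀)`, that is,
`∫ |f(x | θ) - f(x | θ₀) - (θ - θ₀)ᵀ s(x, θ₀) f(x | θ₀)| dx = o(‖θ - θ₀‖)`. -/
structure DifferentiableInMeanAt (f : Vec p → ℝ → ℝ) (θ₀ : Vec p) : Prop where
  differentiableAt_log : ∀ᵐ x ∂(law f θ₀),
    DifferentiableAt ℝ (fun η : Vec p => Real.log (f η x)) θ₀
  integrable_score : Integrable (score f θ₀) (law f θ₀)
  isLittleO : (fun θ : Vec p =>
      ∫ x, |f θ x - f θ₀ x - inner ℝ (θ - θ₀) (score f θ₀ x) * f θ₀ x|)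
    =o[𝓝 θ₀] fun θ => θ - θ₀

/-- The estimators `θ̂ₙ = est n (x₁, …, xₙ)` satisfy, for the sample `X`, the representation
`√n (θ̂ₙ - θ₀) - R_{θ₀}⁻¹ n^{-1/2} ∑ᵢ r(Xᵢ, θ₀) → 0` in probability, where the influence
function `r(·, θ₀)` is centred and square integrable under `F(· | θ₀)`, with positive definite
covariance matrix `R_{θ₀}`. -/
structure HasLinearRepresentation {Ω : Type*} [MeasurableSpace Ω] (P : Measure Ω)
    (X : ℕ → Ω → ℝ) (f : Vec p → ℝ → ℝ) (r : Vec p → ℝ → Vec p)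
    (est : (n : ℕ) → (Fin n → ℝ) → Vec p) (θ₀ : Vec p) : Prop where
  memLp : MemLp (r θ₀) 2 (law f θ₀)
  integral_eq_zero : ∫ x, r θ₀ x ∂(law f θ₀) = 0
  posDef : (matR f r θ₀).PosDef
  tendsto : TendstoInMeasure P
    (fun (n : ℕ) ω =>
      √(n : ℝ) • (est n (fun i => X i ω) - θ₀)
        - Matrix.toEuclideanCLM (𝕜 := ℝ) (matR f r θ₀)⁻¹
            ((√(n : ℝ))⁻¹ • ∑ i ∈ Finset.range n, r θ₀ (X i ω)))
    atTop (fun _ => 0)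

end TrigGOF

open TrigGOF

/-! The heart is an expansion of `tau` in the parameter that is uniform in the observation. The
remainder of F(x | θ) at `θ₀` is the integral over a half line of the remainder of the density, so
its absolute value is at most the L¹ remainder, which is o(‖θ - θ₀‖) and free of x. A Taylor bound
carries this over to `tau` (`exists_isLittleO_tau`), so that a random parameter can be inserted and
the expansion averaged over the sample with no further control of θ.

Since `√n (θ̂ - θ₀)` is bounded in probability, `√n τ̄ₙ(θ̂)` equals `√n τ̄ₙ(θ₀)` plus the pairing of
`√n (θ̂ - θ₀)` with the sample mean of the gradients of `tau`, up to o_P(1). By the law of large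
numbers that mean tends to its expectation, which is -G: F(X | θ) is uniform under θ, hence E_θ τ(X,
θ) = 0 near `θ₀`, and this identity can be differentiated (`integral_tauGrad`). Inserting the linear
representation of the estimator gives the influence function τ - G R⁻¹ r
(`tendstoInMeasure_sqrt_smul_tauBar_sub`). Its covariance is Σ, because E ττᵀ = ½ I
(`sigma_eq_integral`).

The multivariate central limit theorem now gives a Gaussian limit with covariance Σ at `θ₀`.
Continuity of Σ at `θ₀` and Slutsky's theorem allow standardizing by the estimated matrix. -/

namespace TrigGOF

/-! ### Calculus of o_P(1) and O_P(1). -/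

section Stochastic

variable {Ω : Type*} [MeasurableSpace Ω] {P : Measure Ω}
  {E F : Type*} [NormedAddCommGroup E] [NormedAddCommGroup F]

/-- A sequence of random vectors is bounded in probability (uniformly tight, `O_P(1)`). -/
def BoundedInProb (P : Measure Ω) (U : ℕ → Ω → E) : Prop :=
  ∀ η : ENNReal, 0 < η → ∃ K : ℝ, 0 < K ∧ ∀ᶠ n in atTop, P {ω | K ≤ ‖U n ω‖} ≤ η

lemma tendstoInMeasure_zero_iff {U : ℕ → Ω → E} :
    TendstoInMeasure P U atTop (fun _ => 0) ↔
      ∀ ε : ℝ, 0 < ε → ∀ η : ENNReal, 0 < η → ∀ᶠ n in atTop, P {ω | ε ≤ ‖U n ω‖} ≤ η := by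
  rw [tendstoInMeasure_iff_norm]
  simp only [sub_zero, ENNReal.tendsto_nhds_zero]

lemma tendstoInMeasure_zero_of_norm_le_add {U : ℕ → Ω → E} {V W : ℕ → Ω → F}
    (hV : TendstoInMeasure P V atTop (fun _ => 0)) (hW : TendstoInMeasure P W atTop (fun _ => 0))
    (h : ∀ n ω, ‖U n ω‖ ≤ ‖V n ω‖ + ‖W n ω‖) :
    TendstoInMeasure P U atTop (fun _ => 0) := by
  rw [tendstoInMeasure_zero_iff] at *
  intro ε hε η hη
  filter_upwards [hV (ε / 2) (by positivity) (η / 2) (ENNReal.half_pos hη.ne'),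
    hW (ε / 2) (by positivity) (η / 2) (ENNReal.half_pos hη.ne')] with n h1 h2
  calc P {ω | ε ≤ ‖U n ω‖} ≤ P ({ω | ε / 2 ≤ ‖V n ω‖} ∪ {ω | ε / 2 ≤ ‖W n ω‖}) := by
        refine measure_mono fun ω hω => ?_
        simp only [Set.mem_union, Set.mem_ofPred_eq] at *
        by_contra! hc
        linarith [h n ω]
    _ ≤ η / 2 + η / 2 := (measure_union_le _ _).trans (add_le_add h1 h2)
    _ = η := ENNReal.add_halves η

lemma tendstoInMeasure_zero_of_norm_le {U : ℕ → Ω → E} {V : ℕ → Ω → F}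
    (hV : TendstoInMeasure P V atTop (fun _ => 0)) (h : ∀ n ω, ‖U n ω‖ ≤ ‖V n ω‖) :
    TendstoInMeasure P U atTop (fun _ => 0) :=
  tendstoInMeasure_zero_of_norm_le_add hV hV
    fun n ω => (h n ω).trans (le_add_of_nonneg_left (norm_nonneg _))

lemma tendstoInMeasure_zero_add {V W : ℕ → Ω → E}
    (hV : TendstoInMeasure P V atTop (fun _ => 0)) (hW : TendstoInMeasure P W atTop (fun _ => 0)) :
    TendstoInMeasure P (fun n ω => V n ω + W n ω) atTop (fun _ => 0) :=
  tendstoInMeasure_zero_of_norm_le_add hV hW fun _ _ => norm_add_le _ _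

/-- The rule o_P(1) · O_P(1) = o_P(1): a product of size ε forces either the bounded factor above K
or the small factor above ε / K. -/
lemma tendstoInMeasure_zero_of_norm_le_mul {G : Type*} [NormedAddCommGroup G]
    {V : ℕ → Ω → G} {A : ℕ → Ω → E} {U : ℕ → Ω → F}
    (hA : TendstoInMeasure P A atTop (fun _ => 0)) (hU : BoundedInProb P U)
    (h : ∀ n ω, ‖V n ω‖ ≤ ‖A n ω‖ * ‖U n ω‖) :
    TendstoInMeasure P V atTop (fun _ => 0) := by
  rw [tendstoInMeasure_zero_iff] at *
  intro ε hε η hη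
  obtain ⟨K, hK, hU⟩ := hU (η / 2) (ENNReal.half_pos hη.ne')
  filter_upwards [hA (ε / K) (by positivity) (η / 2) (ENNReal.half_pos hη.ne'), hU] with n h1 h2
  calc P {ω | ε ≤ ‖V n ω‖} ≤ P ({ω | ε / K ≤ ‖A n ω‖} ∪ {ω | K ≤ ‖U n ω‖}) := by
        refine measure_mono fun ω hω => ?_
        simp only [Set.mem_union, Set.mem_ofPred_eq] at *
        by_contra! hc
        have h3 : ‖A n ω‖ * ‖U n ω‖ ≤ ‖A n ω‖ * K := by gcongr; exact hc.2.le
        have h4 : ‖A n ω‖ * K < ε := by rw [← lt_div_iff₀ hK]; exact hc.1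
        linarith [h n ω]
    _ ≤ η / 2 + η / 2 := (measure_union_le _ _).trans (add_le_add h1 h2)
    _ = η := ENNReal.add_halves η

lemma BoundedInProb.of_sub {U V : ℕ → Ω → E}
    (hV : BoundedInProb P V) (h : TendstoInMeasure P (fun n ω => U n ω - V n ω) atTop fun _ => 0) :
    BoundedInProb P U := by
  intro η hη
  obtain ⟨K, hK, hV⟩ := hV (η / 2) (ENNReal.half_pos hη.ne')
  refine ⟨K + 1, by positivity, ?_⟩
  filter_upwards [hV, tendstoInMeasure_zero_iff.1 h 1 one_pos (η / 2) (ENNReal.half_pos hη.ne')]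
    with n h1 h2
  calc P {ω | K + 1 ≤ ‖U n ω‖} ≤ P ({ω | K ≤ ‖V n ω‖} ∪ {ω | 1 ≤ ‖U n ω - V n ω‖}) := by
        refine measure_mono fun ω hω => ?_
        simp only [Set.mem_union, Set.mem_ofPred_eq] at *
        by_contra! hc
        have := norm_sub_norm_le (U n ω) (V n ω)
        linarith [hc.1, hc.2]
    _ ≤ η / 2 + η / 2 := (measure_union_le _ _).trans (add_le_add h1 h2)
    _ = η := ENNReal.add_halves η

variable [NormedSpace ℝ E]

/-- If `√n (θₙ - θ₀)` is bounded in probability, then `θₙ` eventually lies in each neighbourhood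
of `θ₀` where `√n (θₙ - θ₀)` is bounded, off a set of small probability. -/
lemma BoundedInProb.eventually_mem {T : ℕ → Ω → E} {θ₀ : E}
    (hU : BoundedInProb P fun n ω => √(n : ℝ) • (T n ω - θ₀)) (η : ENNReal) (hη : 0 < η) :
    ∃ K : ℝ, 0 < K ∧ ∀ N ∈ 𝓝 θ₀, ∀ᶠ n in atTop,
      P {ω | ¬ (T n ω ∈ N ∧ ‖√(n : ℝ) • (T n ω - θ₀)‖ < K)} ≤ η := by
  obtain ⟨K, hK, hU⟩ := hU η hη
  refine ⟨K, hK, fun N hN => ?_⟩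
  obtain ⟨δ, hδ, hδN⟩ := Metric.mem_nhds_iff.1 hN
  have hs : Tendsto (fun n : ℕ => √(n : ℝ)) atTop atTop :=
    Real.tendsto_sqrt_atTop.comp tendsto_natCast_atTop_atTop
  filter_upwards [hU, hs.eventually_ge_atTop (K / δ), hs.eventually_gt_atTop 0] with n h1 h2 h3
  refine (measure_mono fun ω hω => ?_).trans h1
  simp only [Set.mem_ofPred_eq] at *
  by_contra! hc
  refine hω ⟨hδN ?_, hc⟩
  rw [Metric.mem_ball, dist_eq_norm]
  rw [norm_smul, Real.norm_of_nonneg (Real.sqrt_nonneg _)] at hc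
  rw [div_le_iff₀ hδ] at h2
  exact lt_of_mul_lt_mul_left (hc.trans_le h2) h3.le

/-- Continuity at the single point `θ₀` suffices, since `T n` lies in any given neighbourhood of
`θ₀` up to small probability. -/
lemma BoundedInProb.tendstoInMeasure_comp {T : ℕ → Ω → E} {θ₀ : E}
    (hU : BoundedInProb P fun n ω => √(n : ℝ) • (T n ω - θ₀)) {h : E → F}
    (hh : ContinuousAt h θ₀) :
    TendstoInMeasure P (fun n ω => h (T n ω)) atTop (fun _ => h θ₀) := by
  suffices TendstoInMeasure P (fun n ω => h (T n ω) - h θ₀) atTop (fun _ => 0) by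
    rw [tendstoInMeasure_iff_norm] at *
    simpa using this
  rw [tendstoInMeasure_zero_iff]
  intro ε hε η hη
  obtain ⟨K, hK, hN⟩ := hU.eventually_mem η hη
  filter_upwards [hN _ (Metric.continuousAt_iff'.1 hh ε hε)] with n hn
  refine (measure_mono fun ω hω => ?_).trans hn
  simp only [Set.mem_ofPred_eq] at *
  intro hc
  have := hc.1
  rw [dist_eq_norm] at this
  linarith

/-- The remainder estimate of the delta method. The slope ε / (2K) is chosen so that, where `√n ‖T n
- θ₀‖ < K`, the scaled remainder is at most ε / 2. -/
lemma BoundedInProb.tendstoInMeasure_isLittleO {T : ℕ → Ω → E} {θ₀ : E}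
    (hU : BoundedInProb P fun n ω => √(n : ℝ) • (T n ω - θ₀)) {h : E → ℝ}
    (hh : h =o[𝓝 θ₀] fun θ => θ - θ₀) :
    TendstoInMeasure P (fun (n : ℕ) ω => √(n : ℝ) * h (T n ω)) atTop (fun _ => 0) := by
  rw [tendstoInMeasure_zero_iff]
  intro ε hε η hη
  obtain ⟨K, hK, hN⟩ := hU.eventually_mem η hη
  filter_upwards [hN _ (hh.def (c := ε / (2 * K)) (by positivity))] with n hn
  refine (measure_mono fun ω hω => ?_).trans hn
  simp only [Set.mem_ofPred_eq] at *
  rintro ⟨h1, h2⟩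
  rw [norm_mul, Real.norm_of_nonneg (Real.sqrt_nonneg _)] at hω
  rw [norm_smul, Real.norm_of_nonneg (Real.sqrt_nonneg _)] at h2
  have : √(n : ℝ) * ‖h (T n ω)‖ ≤ ε / (2 * K) * K := by
    calc √(n : ℝ) * ‖h (T n ω)‖ ≤ √(n : ℝ) * (ε / (2 * K) * ‖T n ω - θ₀‖) := by gcongr
      _ = ε / (2 * K) * (√(n : ℝ) * ‖T n ω - θ₀‖) := by ring
      _ ≤ _ := by gcongr
  have h3 : ε / (2 * K) * K = ε / 2 := by field_simp
  linarith

end Stochastic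

/-! ### Convergence in distribution and the multivariate central limit theorem. -/

section Distribution

variable {Ω : Type*} [MeasurableSpace Ω] {P : Measure Ω} [IsProbabilityMeasure P]
  {Ω' : Type*} [MeasurableSpace Ω'] {P' : Measure Ω'} [IsProbabilityMeasure P']
  {Ω'' : Type*} [MeasurableSpace Ω''] {P'' : Measure Ω''} [IsProbabilityMeasure P'']

/-- Only the law of the limit matters. This exchanges the transformed Gaussian limits for the
standard ones. -/
lemma TendstoInDistribution.of_map_eq {E : Type*} [TopologicalSpace E] [MeasurableSpace E]
    [OpensMeasurableSpace E] {X : ℕ → Ω → E} {Z : Ω' → E} {Z' : Ω'' → E}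
    (h : TendstoInDistribution X atTop Z (fun _ => P) P') (hZ' : AEMeasurable Z' P'')
    (hmap : P'.map Z = P''.map Z') :
    TendstoInDistribution X atTop Z' (fun _ => P) P'' where
  forall_aemeasurable := h.forall_aemeasurable
  aemeasurable_limit := hZ'
  tendsto := by
    have hlim : (⟨P''.map Z', Measure.isProbabilityMeasure_map hZ'⟩ : ProbabilityMeasure E)
        = ⟨P'.map Z, Measure.isProbabilityMeasure_map h.aemeasurable_limit⟩ :=
      Subtype.ext hmap.symm
    rw [hlim]
    exact h.tendsto

/-- The closed sets where ‖x‖ ≥ k decrease to the empty set, so one of them has small limiting mass;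
the portmanteau inequality for closed sets then bounds the mass along the sequence. -/
lemma TendstoInDistribution.boundedInProb {E : Type*} [NormedAddCommGroup E] [MeasurableSpace E]
    [BorelSpace E] {X : ℕ → Ω → E} {Z : Ω' → E}
    (h : TendstoInDistribution X atTop Z (fun _ => P) P') : BoundedInProb P X := by
  intro η hη
  have hlim : Tendsto (fun k : ℕ => (P'.map Z) {x | (k : ℝ) ≤ ‖x‖}) atTop (𝓝 0) := by
    have := h.aemeasurable_limit
    have : IsProbabilityMeasure (P'.map Z) := Measure.isProbabilityMeasure_map this
    have h0 : (P'.map Z) (⋂ k : ℕ, {x : E | (k : ℝ) ≤ ‖x‖}) = 0 := by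
      convert measure_empty (μ := P'.map Z)
      ext x
      simp only [Set.mem_iInter, Set.mem_ofPred_eq, Set.mem_empty_iff_false, iff_false, not_forall,
        not_le]
      exact exists_nat_gt _
    rw [← h0]
    refine tendsto_measure_iInter_atTop
      (fun k => (isClosed_le continuous_const continuous_norm).measurableSet.nullMeasurableSet)
      (fun a b hab x hx => ?_) ⟨0, measure_ne_top _ _⟩
    simp only [Set.mem_ofPred_eq] at *
    exact le_trans (by exact_mod_cast hab) hx
  obtain ⟨k, hk, hk0⟩ := ((hlim.eventually_lt_const hη).and (eventually_gt_atTop 0)).exists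
  refine ⟨k, by exact_mod_cast hk0, ?_⟩
  have hc : IsClosed {x : E | (k : ℝ) ≤ ‖x‖} := isClosed_le continuous_const continuous_norm
  have := ProbabilityMeasure.limsup_measure_closed_le_of_tendsto h.tendsto hc
  have := eventually_lt_of_limsup_lt (this.trans_lt hk)
  filter_upwards [this] with n hn
  simp only [ProbabilityMeasure.coe_mk] at hn
  rw [Measure.map_apply_of_aemeasurable (h.forall_aemeasurable n) hc.measurableSet] at hn
  exact hn.le

/-- The second moment matrix of a square integrable random vector is positive semidefinite. -/
lemma posSemidef_of_integral_mul {ι : Type*} [Fintype ι] {μ : Measure Ω}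
    {Y : Ω → EuclideanSpace ℝ ι} (hY : MemLp Y 2 μ) {S : Matrix ι ι ℝ}
    (hS : ∀ i j, S i j = ∫ ω, Y ω i * Y ω j ∂μ) :
    S.PosSemidef ∧ ∀ t : EuclideanSpace ℝ ι,
      ∫ ω, inner ℝ t (Y ω) ^ 2 ∂μ = t.ofLp ⬝ᵥ S *ᵥ t.ofLp := by
  have hi : ∀ i, MemLp (fun ω => Y ω i) 2 μ := fun i =>
    (EuclideanSpace.proj (𝕜 := ℝ) i).comp_memLp' hY
  have key : ∀ t : EuclideanSpace ℝ ι,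
      ∫ ω, inner ℝ t (Y ω) ^ 2 ∂μ = t.ofLp ⬝ᵥ S *ᵥ t.ofLp := by
    intro t
    have h1 : ∀ ω, inner ℝ t (Y ω) ^ 2 = ∑ i, ∑ j, (t i * t j) * (Y ω i * Y ω j) := by
      intro ω
      rw [PiLp.inner_apply, sq, Finset.sum_mul_sum]
      refine Finset.sum_congr rfl fun i _ => Finset.sum_congr rfl fun j _ => ?_
      simp
      ring
    simp_rw [h1]
    have h2 : ∀ i j, Integrable (fun ω => t i * t j * (Y ω i * Y ω j)) μ := fun i j =>
      ((hi i).integrable_mul (hi j)).const_mul _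
    rw [integral_finsetSum _ fun i _ => integrable_finsetSum _ fun j _ => h2 i j]
    simp_rw [integral_finsetSum _ fun j _ => h2 _ j,
      integral_const_mul, ← hS]
    simp only [dotProduct, Matrix.mulVec, Finset.mul_sum]
    refine Finset.sum_congr rfl fun i _ => Finset.sum_congr rfl fun j _ => ?_
    ring
  refine ⟨Matrix.PosSemidef.of_dotProduct_mulVec_nonneg ?_ fun x => ?_, key⟩
  · ext i j
    simp [hS, mul_comm]
  · have := key (WithLp.toLp 2 x)
    simp only [star_trivial]
    rw [← this]
    positivity

/-- **Multivariate central limit theorem** for centred random vectors. -/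
theorem tendstoInDistribution_multivariate {ι : Type*} [Fintype ι] [DecidableEq ι]
    {Y : ℕ → Ω → EuclideanSpace ℝ ι} (hindep : iIndepFun Y P)
    (hident : ∀ i, IdentDistrib (Y i) (Y 0) P P) (hY : MemLp (Y 0) 2 P) (h0 : P[Y 0] = 0)
    {S : Matrix ι ι ℝ} (hS : ∀ i j, S i j = ∫ ω, Y 0 ω i * Y 0 ω j ∂P) :
    TendstoInDistribution (fun (n : ℕ) ω => (√(n : ℝ))⁻¹ • ∑ k ∈ Finset.range n, Y k ω) atTop
      (id : EuclideanSpace ℝ ι → _) (fun _ => P) (multivariateGaussian 0 S) where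
  forall_aemeasurable n :=
    (Finset.aemeasurable_fun_sum (Finset.range n)
      fun k _ => (hident k).aemeasurable_fst).fun_const_smul _
  tendsto := by
    obtain ⟨hpsd, hvar⟩ := posSemidef_of_integral_mul hY hS
    refine ProbabilityMeasure.tendsto_iff_tendsto_charFun.2 fun t => ?_
    have hm : Measurable fun y : EuclideanSpace ℝ ι => inner ℝ t y := by fun_prop
    have hYt : MemLp (fun ω => inner ℝ t (Y 0 ω)) 2 P := hY.const_inner t
    have hEt : ∫ ω, inner ℝ t (Y 0 ω) ∂P = 0 := by
      rw [integral_inner (hY.integrable (by norm_num)), h0, inner_zero_right]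
    have hV : Var[fun ω => inner ℝ t (Y 0 ω); P] = t.ofLp ⬝ᵥ S *ᵥ t.ofLp := by
      rw [variance_of_integral_eq_zero hYt.aestronglyMeasurable.aemeasurable hEt, ← hvar]
    have h1 := tendstoInDistribution_inv_sqrt_mul_sum_sub (X := fun k ω => inner ℝ t (Y k ω))
      (Y := id) (P' := gaussianReal 0 (Var[fun ω => inner ℝ t (Y 0 ω); P]).toNNReal)
      HasLaw.id hYt (hindep.comp (fun _ y => inner ℝ t y) fun _ => hm)
      (fun i => (hident i).comp hm)
    -- Cramér–Wold device: the characteristic function of a vector at `t` is that of its projection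
    -- on `t` at 1, so the scalar theorem suffices.
    have h2 := ProbabilityMeasure.tendsto_iff_tendsto_charFun.1 h1.tendsto 1
    simp only [ProbabilityMeasure.coe_mk, Measure.map_id, hEt, mul_zero, sub_zero] at h2 ⊢
    rw [charFun_multivariateGaussian hpsd]
    rw [charFun_gaussianReal, hV, Real.coe_toNNReal _
      (by simpa using hpsd.dotProduct_mulVec_nonneg t.ofLp)] at h2
    have h3 : ∀ n : ℕ, charFun (P.map fun ω => (√(n : ℝ))⁻¹ *
        ∑ k ∈ Finset.range n, inner ℝ t (Y k ω)) 1
        = charFun (P.map fun ω => (√(n : ℝ))⁻¹ • ∑ k ∈ Finset.range n, Y k ω) t := by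
      intro n
      have hmeas : AEMeasurable (fun ω => (√(n : ℝ))⁻¹ • ∑ k ∈ Finset.range n, Y k ω) P :=
        (Finset.aemeasurable_fun_sum (Finset.range n)
          fun k _ => (hident k).aemeasurable_fst).fun_const_smul _
      have h4 : (fun ω => (√(n : ℝ))⁻¹ * ∑ k ∈ Finset.range n, inner ℝ t (Y k ω))
          = (fun y => inner ℝ t y) ∘ fun ω => (√(n : ℝ))⁻¹ • ∑ k ∈ Finset.range n, Y k ω := by
        ext ω
        simp [inner_smul_right, inner_sum]
      rw [h4, ← AEMeasurable.map_map_of_aemeasurable hm.aemeasurable hmeas, charFun_apply_real,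
        charFun_apply, integral_map hm.aemeasurable (by fun_prop)]
      simp [real_inner_comm]
    simp_rw [h3] at h2
    convert! h2 using 2
    congr 1
    simp

end Distribution

/-! ### Square roots and inverses of symmetric 2 × 2 matrices: continuity and measurability. -/

section TwoByTwo

/-- Completing the square: `A 0 0` times the quadratic form is (A₀₀x₀ + A₀₁x₁)² + det A · x₁². If `A
0 0` vanishes, the determinant condition kills the off-diagonal entry. -/
lemma posSemidef_fin_two_iff {A : Matrix (Fin 2) (Fin 2) ℝ} (hA : A.IsSymm) :
    A.PosSemidef ↔ 0 ≤ A 0 0 ∧ 0 ≤ A 1 1 ∧ 0 ≤ A.det := by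
  have h10 : A 1 0 = A 0 1 := hA.apply 0 1
  refine ⟨fun h => ⟨h.diag_nonneg, h.diag_nonneg, h.det_nonneg⟩, fun ⟨h0, h1, hd⟩ => ?_⟩
  refine Matrix.PosSemidef.of_dotProduct_mulVec_nonneg hA.eq
    fun x => ?_
  rw [Matrix.det_fin_two, h10] at hd
  simp only [star_trivial, dotProduct, Matrix.mulVec, Fin.sum_univ_two, h10]
  have key : 0 ≤ A 0 0 * (x 0 * (A 0 0 * x 0 + A 0 1 * x 1)
      + x 1 * (A 0 1 * x 0 + A 1 1 * x 1)) := by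
    nlinarith [sq_nonneg (A 0 0 * x 0 + A 0 1 * x 1), mul_nonneg hd (sq_nonneg (x 1))]
  rcases h0.eq_or_lt with h | h
  · have hb : A 0 1 = 0 := by nlinarith
    rw [← h, hb]
    nlinarith [mul_nonneg h1 (sq_nonneg (x 1))]
  · exact nonneg_of_mul_nonneg_right key h

/-- The positive semidefinite square root of a positive semidefinite `2 × 2` matrix, in closed
form. -/
noncomputable def sqrtTwo (A : Matrix (Fin 2) (Fin 2) ℝ) : Matrix (Fin 2) (Fin 2) ℝ :=
  (√(A.trace + 2 * √A.det))⁻¹ • (A + √A.det • 1)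

/-- By Cayley–Hamilton, with d² = det A, one has (A + d I)² = A² + 2dA + d² I = (tr A + 2d) A. -/
lemma sqrtTwo_mul_self {A : Matrix (Fin 2) (Fin 2) ℝ} (hA : A.IsSymm) (hp : A.PosSemidef) :
    sqrtTwo A * sqrtTwo A = A := by
  obtain ⟨h0, h1, hd⟩ := (posSemidef_fin_two_iff hA).1 hp
  have h10 : A 1 0 = A 0 1 := hA.apply 0 1
  have ht : A.trace = A 0 0 + A 1 1 := Matrix.trace_fin_two A
  have hs := Real.mul_self_sqrt hd
  have hs0 := Real.sqrt_nonneg A.det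
  set d := √A.det with hd'
  have hnn : 0 ≤ A.trace + 2 * d := by rw [ht]; positivity
  have hsq : (A + d • 1) * (A + d • 1) = (A.trace + 2 * d) • A := by
    rw [Matrix.det_fin_two, h10] at hs
    ext i j
    fin_cases i <;> fin_cases j <;>
      simp [Matrix.mul_apply, Fin.sum_univ_two, ht, h10] <;> nlinarith
  rw [sqrtTwo, ← hd', Matrix.smul_mul, Matrix.mul_smul, smul_smul, hsq, smul_smul, ← mul_inv,
    Real.mul_self_sqrt hnn]
  -- If tr A + 2d = 0 then A = 0, and the convention that 0 has inverse 0 makes both sides vanish.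
  rcases hnn.eq_or_lt with h | h
  · have ha : A 0 0 = 0 := by linarith
    have hc : A 1 1 = 0 := by linarith
    have hb : A 0 1 = 0 := by
      rw [Matrix.det_fin_two, h10, ha, hc] at hd
      nlinarith
    ext i j
    fin_cases i <;> fin_cases j <;> simp [ha, hb, hc, h10]
  · rw [inv_mul_cancel₀ h.ne', one_smul]

lemma cfc_sqrt_eq_sqrtTwo {A : Matrix (Fin 2) (Fin 2) ℝ} (hA : A.IsSymm) (hp : A.PosSemidef) :
    CFC.sqrt A = sqrtTwo A := by
  refine CFC.sqrt_unique (sqrtTwo_mul_self hA hp) ?_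
  rw [Matrix.nonneg_iff_posSemidef, sqrtTwo]
  exact (hp.add (Matrix.PosSemidef.one.smul (Real.sqrt_nonneg _))).smul
    (inv_nonneg.2 (Real.sqrt_nonneg _))

lemma cfc_sqrt_of_not_posSemidef {A : Matrix (Fin 2) (Fin 2) ℝ} (hp : ¬ A.PosSemidef) :
    CFC.sqrt A = 0 := by
  rw [CFC.sqrt, cfcₙ_apply_of_not_predicate]
  rwa [Matrix.nonneg_iff_posSemidef]

/-- The strict inequalities are open conditions, so the closed form of the square root remains
available near a positive definite value. -/
lemma posSemidef_and_det_ne_zero_iff {A : Matrix (Fin 2) (Fin 2) ℝ} (hA : A.IsSymm) :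
    (A.PosSemidef ∧ A.det ≠ 0) ↔ 0 < A 0 0 ∧ 0 < A 1 1 ∧ 0 < A.det := by
  rw [posSemidef_fin_two_iff hA]
  have h10 : A 1 0 = A 0 1 := hA.apply 0 1
  constructor
  · rintro ⟨⟨h0, h1, hd⟩, hne⟩
    have hd : 0 < A.det := lt_of_le_of_ne hd hne.symm
    have h2 := hd
    rw [Matrix.det_fin_two, h10] at h2
    have h3 : 0 < A 0 0 * A 1 1 := by nlinarith [mul_self_nonneg (A 0 1)]
    exact ⟨pos_of_mul_pos_left h3 h1, pos_of_mul_pos_right h3 h0, hd⟩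
  · rintro ⟨h0, h1, hd⟩
    exact ⟨⟨h0.le, h1.le, hd.le⟩, hd.ne'⟩

lemma continuousAt_inv_fin_two {T : Type*} [TopologicalSpace T]
    {g : T → Matrix (Fin 2) (Fin 2) ℝ} {t : T} (hg : ContinuousAt g t) (hd : (g t).det ≠ 0) :
    ContinuousAt (fun s => (g s)⁻¹) t := by
  simp_rw [Matrix.inv_def, Ring.inverse_eq_inv']
  have h1 : ContinuousAt (fun s => (g s).det) t :=
    (continuous_id.matrix_det).continuousAt.comp hg
  have h2 : ContinuousAt (fun s => (g s).adjugate) t :=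
    (continuous_id.matrix_adjugate).continuousAt.comp hg
  exact (h1.inv₀ hd).smul h2

lemma continuousAt_invSqrt {T : Type*} [TopologicalSpace T]
    {g : T → Matrix (Fin 2) (Fin 2) ℝ} {t : T} (hg : ContinuousAt g t)
    (hsymm : ∀ s, (g s).IsSymm) (hp : (g t).PosSemidef) (hd : (g t).det ≠ 0) :
    ContinuousAt (fun s => invSqrt (g s)) t := by
  obtain ⟨h0, h1, h2⟩ := (posSemidef_and_det_ne_zero_iff (hsymm t)).1 ⟨hp, hd⟩
  have hij : ∀ i j, ContinuousAt (fun s => g s i j) t := fun i j =>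
    (continuous_id.matrix_elem i j).continuousAt.comp hg
  have hdet : ContinuousAt (fun s => (g s).det) t :=
    (continuous_id.matrix_det).continuousAt.comp hg
  have htr : ContinuousAt (fun s => (g s).trace) t :=
    (continuous_id.matrix_trace).continuousAt.comp hg
  have hev : (fun s => invSqrt (g s)) =ᶠ[𝓝 t] fun s => (sqrtTwo (g s))⁻¹ := by
    filter_upwards [(hij 0 0).eventually_const_lt h0, (hij 1 1).eventually_const_lt h1,
      hdet.eventually_const_lt h2] with s a0 a1 a2
    rw [invSqrt, cfc_sqrt_eq_sqrtTwo (hsymm s)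
      ((posSemidef_and_det_ne_zero_iff (hsymm s)).2 ⟨a0, a1, a2⟩).1]
  refine ContinuousAt.congr ?_ hev.symm
  refine continuousAt_inv_fin_two ?_ fun h => hd ?_
  · have hsd : ContinuousAt (fun s => √(g s).det) t := Real.continuous_sqrt.continuousAt.comp hdet
    have hn : ContinuousAt (fun s => √((g s).trace + 2 * √(g s).det)) t :=
      Real.continuous_sqrt.continuousAt.comp (htr.add (hsd.const_mul 2))
    refine (hn.inv₀ ?_).smul (hg.add (hsd.smul continuousAt_const))
    rw [Matrix.trace_fin_two]
    positivity
  · rw [← sqrtTwo_mul_self (hsymm t) hp, Matrix.det_mul, h, mul_zero]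

lemma measurable_inv_fin_two {T : Type*} [MeasurableSpace T] {g : T → Matrix (Fin 2) (Fin 2) ℝ}
    (hg : ∀ i j, Measurable fun s => g s i j) (i j : Fin 2) :
    Measurable fun s => (g s)⁻¹ i j := by
  simp_rw [Matrix.inv_def, Ring.inverse_eq_inv', Matrix.det_fin_two, Matrix.adjugate_fin_two]
  have h00 := hg 0 0
  have h01 := hg 0 1
  have h10 := hg 1 0
  have h11 := hg 1 1
  fin_cases i <;> fin_cases j <;> simp <;> fun_prop

/-- The estimator may hit parameters where the matrix is not positive semidefinite. There `CFC.sqrt`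
takes the value 0, so the root is a measurable case distinction between `sqrtTwo` and 0. -/
lemma measurable_invSqrt {T : Type*} [MeasurableSpace T] {g : T → Matrix (Fin 2) (Fin 2) ℝ}
    (hg : ∀ i j, Measurable fun s => g s i j) (hsymm : ∀ s, (g s).IsSymm) (i j : Fin 2) :
    Measurable fun s => invSqrt (g s) i j := by
  refine measurable_inv_fin_two (g := fun s => CFC.sqrt (g s)) (fun i j => ?_) i j
  have hdet : Measurable fun s => (g s).det := by
    simp_rw [Matrix.det_fin_two]
    exact ((hg 0 0).mul (hg 1 1)).sub ((hg 0 1).mul (hg 1 0))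
  have htr : Measurable fun s => (g s).trace := by
    simp_rw [Matrix.trace_fin_two]
    exact (hg 0 0).add (hg 1 1)
  classical
  have heq : (fun s => CFC.sqrt (g s) i j) = fun s =>
      if 0 ≤ g s 0 0 ∧ 0 ≤ g s 1 1 ∧ 0 ≤ (g s).det then sqrtTwo (g s) i j else 0 := by
    ext s
    split_ifs with h
    · rw [cfc_sqrt_eq_sqrtTwo (hsymm s) ((posSemidef_fin_two_iff (hsymm s)).2 h)]
    · rw [cfc_sqrt_of_not_posSemidef (mt (posSemidef_fin_two_iff (hsymm s)).1 h)]
      rfl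
  rw [heq]
  refine Measurable.ite ?_ ?_ measurable_const
  · exact (measurableSet_le measurable_const (hg 0 0)).inter
      ((measurableSet_le measurable_const (hg 1 1)).inter (measurableSet_le measurable_const hdet))
  · simp only [sqrtTwo, Matrix.smul_apply, Matrix.add_apply, smul_eq_mul]
    have := hg i j
    fun_prop

lemma invSqrt_mul_sqrt {A : Matrix (Fin 2) (Fin 2) ℝ} (hp : A.PosSemidef) (hd : A.det ≠ 0) :
    invSqrt A * CFC.sqrt A = 1 := by
  refine Matrix.nonsing_inv_mul _ (isUnit_iff_ne_zero.2 fun h => hd ?_)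
  rw [← CFC.sqrt_mul_sqrt_self A hp.nonneg, Matrix.det_mul, h, mul_zero]

end TwoByTwo

/-! ### The probability integral transform. -/

section ProbabilityIntegralTransform

/-- When nonempty, the sublevel set is a closed half line ending at its supremum, where continuity
forces the value `u`. When empty, the limit at -∞ gives u ≤ 0 and both sides vanish. -/
lemma measure_cdf_le_eq {ν : Measure ℝ} [IsProbabilityMeasure ν] (hF : Continuous (cdf ν))
    {u : ℝ} (h1 : u < 1) : ν {x | cdf ν x ≤ u} = ENNReal.ofReal u := by
  obtain ⟨b, hb⟩ := ((tendsto_cdf_atTop ν).eventually_const_lt h1).exists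
  have hbdd : BddAbove {x | cdf ν x ≤ u} := by
    refine ⟨b, fun x hx => ?_⟩
    by_contra! hc
    exact absurd ((monotone_cdf ν hc.le).trans hx) (not_le.2 hb)
  rcases Set.eq_empty_or_nonempty {x | cdf ν x ≤ u} with he | hne
  · have : u ≤ 0 := ge_of_tendsto (tendsto_cdf_atBot ν) (Eventually.of_forall fun x => by
      by_contra! hc
      have : x ∈ {x | cdf ν x ≤ u} := hc.le
      simp [he] at this)
    rw [he, measure_empty, ENNReal.ofReal_of_nonpos this]
  · have hcl : IsClosed {x | cdf ν x ≤ u} := isClosed_le hF continuous_const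
    have hmem : cdf ν (sSup {x | cdf ν x ≤ u}) ≤ u := hcl.csSup_mem hne hbdd
    set x₁ := sSup {x | cdf ν x ≤ u} with hx₁
    have hS : {x | cdf ν x ≤ u} = Set.Iic x₁ := by
      ext x
      exact ⟨fun hx => le_csSup hbdd hx, fun hx => (monotone_cdf ν hx).trans hmem⟩
    have hge : u ≤ cdf ν x₁ := by
      refine ge_of_tendsto (hF.continuousWithinAt (s := Set.Ioi x₁) (x := x₁)).tendsto ?_
      filter_upwards [self_mem_nhdsWithin] with x hx
      by_contra! hc
      have : x ∈ Set.Iic x₁ := hS ▸ hc.le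
      exact (Set.mem_Ioi.1 hx).not_ge this
    rw [hS, ← ofReal_cdf, le_antisymm hmem hge]

/-- **Probability integral transform**: a continuous distribution function maps its law to the
uniform distribution. -/
theorem map_cdf_eq_restrict {ν : Measure ℝ} [IsProbabilityMeasure ν] (hF : Continuous (cdf ν)) :
    ν.map (cdf ν) = volume.restrict (Set.Icc 0 1) := by
  have : IsProbabilityMeasure (ν.map (cdf ν)) :=
    Measure.isProbabilityMeasure_map hF.measurable.aemeasurable
  refine Measure.ext_of_Iic _ _ fun u => ?_
  rw [Measure.map_apply hF.measurable measurableSet_Iic, Measure.restrict_apply measurableSet_Iic]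
  have hpre : cdf ν ⁻¹' Set.Iic u = {x | cdf ν x ≤ u} := rfl
  rw [hpre]
  rcases lt_or_ge u 1 with h1 | h1
  · have h3 : Set.Iic u ∩ Set.Icc 0 1 = Set.Icc 0 u := by
      ext x
      simp only [Set.mem_inter_iff, Set.mem_Iic, Set.mem_Icc]
      exact ⟨fun hx => ⟨hx.2.1, hx.1⟩, fun hx => ⟨hx.2, hx.1, hx.2.trans h1.le⟩⟩
    rw [measure_cdf_le_eq hF h1, h3, Real.volume_Icc, sub_zero]
  · have h2 : {x | cdf ν x ≤ u} = Set.univ := by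
      ext x
      simpa using (cdf_le_one ν x).trans h1
    have h3 : Set.Iic u ∩ Set.Icc 0 1 = Set.Icc 0 1 :=
      Set.inter_eq_right.2 fun x hx => hx.2.trans h1
    rw [h2, h3, measure_univ, Real.volume_Icc]
    simp

lemma integral_comp_cdf {ν : Measure ℝ} [IsProbabilityMeasure ν] (hF : Continuous (cdf ν))
    {φ : ℝ → ℝ} (hφ : Continuous φ) : ∫ x, φ (cdf ν x) ∂ν = ∫ u in (0 : ℝ)..1, φ u := by
  rw [← integral_map hF.measurable.aemeasurable hφ.aestronglyMeasurable, map_cdf_eq_restrict hF,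
    integral_Icc_eq_integral_Ioc, intervalIntegral.integral_of_le zero_le_one]

end ProbabilityIntegralTransform

/-! ### Trigonometric integrals and Taylor bounds. -/

section Trig

/-- The functions `cos(2πu)` and `sin(2πu)`. -/
noncomputable def trig (i : Fin 2) (u : ℝ) : ℝ :=
  ![Real.cos (2 * Real.pi * u), Real.sin (2 * Real.pi * u)] i

/-- The derivatives of `cos(2πu)` and `sin(2πu)`. -/
noncomputable def trigDeriv (i : Fin 2) (u : ℝ) : ℝ :=
  ![-(2 * Real.pi * Real.sin (2 * Real.pi * u)), 2 * Real.pi * Real.cos (2 * Real.pi * u)] i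

lemma continuous_trig (i : Fin 2) : Continuous (trig i) := by
  fin_cases i
  · change Continuous fun u => Real.cos (2 * Real.pi * u)
    fun_prop
  · change Continuous fun u => Real.sin (2 * Real.pi * u)
    fun_prop

lemma continuous_trigDeriv (i : Fin 2) : Continuous (trigDeriv i) := by
  fin_cases i
  · change Continuous fun u => -(2 * Real.pi * Real.sin (2 * Real.pi * u))
    fun_prop
  · change Continuous fun u => 2 * Real.pi * Real.cos (2 * Real.pi * u)
    fun_prop

lemma abs_trig_le_one (i : Fin 2) (u : ℝ) : |trig i u| ≤ 1 := by
  fin_cases i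
  · exact Real.abs_cos_le_one _
  · exact Real.abs_sin_le_one _

lemma abs_trigDeriv_le (i : Fin 2) (u : ℝ) : |trigDeriv i u| ≤ 2 * Real.pi := by
  have hp := Real.pi_pos
  fin_cases i
  · simp only [trigDeriv, Fin.zero_eta, Matrix.cons_val_zero, abs_neg, abs_mul, Nat.abs_ofNat,
      abs_of_pos hp]
    exact mul_le_of_le_one_right (by positivity) (Real.abs_sin_le_one _)
  · simp only [trigDeriv, Fin.mk_one, Matrix.cons_val_one, Matrix.cons_val_fin_one, abs_mul,
      Nat.abs_ofNat, abs_of_pos hp]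
    exact mul_le_of_le_one_right (by positivity) (Real.abs_cos_le_one _)

lemma integral_trig (i : Fin 2) : ∫ u in (0 : ℝ)..1, trig i u = 0 := by
  have hp := Real.pi_pos.ne'
  fin_cases i
  · simp [trig, intervalIntegral.integral_comp_mul_left fun x => Real.cos x]
  · simp [trig, intervalIntegral.integral_comp_mul_left fun x => Real.sin x]

lemma integral_trig_mul_trig (i j : Fin 2) :
    ∫ u in (0 : ℝ)..1, trig i u * trig j u = (1 / 2 : ℝ) * (1 : Matrix (Fin 2) (Fin 2) ℝ) i j := by
  have hp := Real.pi_pos.ne'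
  fin_cases i <;> fin_cases j
  · simp [trig, ← sq, intervalIntegral.integral_comp_mul_left fun x => Real.cos x ^ 2,
      integral_cos_sq]
    field_simp
  · simp only [trig, Fin.zero_eta, Fin.mk_one, Matrix.cons_val_zero, Matrix.cons_val_one,
      Matrix.cons_val_fin_one]
    simp_rw [mul_comm (Real.cos _)]
    simp [intervalIntegral.integral_comp_mul_left fun x => Real.sin x * Real.cos x,
      integral_sin_mul_cos₁]
  · simp [trig, intervalIntegral.integral_comp_mul_left fun x => Real.sin x * Real.cos x,
      integral_sin_mul_cos₁]
  · simp [trig, ← sq, intervalIntegral.integral_comp_mul_left fun x => Real.sin x ^ 2,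
      integral_sin_sq]
    field_simp

lemma abs_sin_sub_self_le (δ : ℝ) : |Real.sin δ - δ| ≤ 2 * δ ^ 2 := by
  rcases le_or_gt |δ| 1 with h | h
  · have h1 := Real.sin_bound h
    have h0 := abs_nonneg δ
    have h2 : |δ| ^ 3 ≤ |δ| ^ 2 := pow_le_pow_of_le_one h0 h (by norm_num)
    have h3 : |δ| ^ 5 ≤ |δ| ^ 2 := pow_le_pow_of_le_one h0 h (by norm_num)
    calc |Real.sin δ - δ| = |(Real.sin δ - (δ - δ ^ 3 / 6)) + -(δ ^ 3 / 6)| := by ring_nf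
      _ ≤ |Real.sin δ - (δ - δ ^ 3 / 6)| + |-(δ ^ 3 / 6)| := abs_add_le _ _
      _ = |Real.sin δ - (δ - δ ^ 3 / 6)| + |δ| ^ 3 / 6 := by
        rw [abs_neg, abs_div, abs_pow]; norm_num
      _ ≤ 2 * |δ| ^ 2 := by nlinarith [sq_nonneg |δ|]
      _ = 2 * δ ^ 2 := by rw [sq_abs]
  · have h1 : |δ| ≤ δ ^ 2 := by rw [← sq_abs]; nlinarith
    calc |Real.sin δ - δ| ≤ |Real.sin δ| + |δ| := abs_sub _ _
      _ ≤ 1 + |δ| := by gcongr; exact Real.abs_sin_le_one _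
      _ ≤ 2 * δ ^ 2 := by linarith

lemma abs_cos_sub_one_le (δ : ℝ) : |Real.cos δ - 1| ≤ δ ^ 2 := by
  rw [abs_le]
  constructor <;> nlinarith [Real.one_sub_sq_div_two_le_cos (x := δ), Real.cos_le_one δ,
    sq_nonneg δ]

lemma abs_cos_add_sub_le (a δ : ℝ) :
    |Real.cos (a + δ) - Real.cos a + Real.sin a * δ| ≤ 3 * δ ^ 2 := by
  have : Real.cos (a + δ) - Real.cos a + Real.sin a * δ
      = Real.cos a * (Real.cos δ - 1) - Real.sin a * (Real.sin δ - δ) := by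
    rw [Real.cos_add]; ring
  rw [this]
  calc _ ≤ |Real.cos a * (Real.cos δ - 1)| + |Real.sin a * (Real.sin δ - δ)| := abs_sub _ _
    _ ≤ 1 * δ ^ 2 + 1 * (2 * δ ^ 2) := by
      rw [abs_mul, abs_mul]
      gcongr
      exacts [Real.abs_cos_le_one _, abs_cos_sub_one_le δ, Real.abs_sin_le_one _,
        abs_sin_sub_self_le δ]
    _ = _ := by ring

lemma abs_sin_add_sub_le (a δ : ℝ) :
    |Real.sin (a + δ) - Real.sin a - Real.cos a * δ| ≤ 3 * δ ^ 2 := by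
  have h := abs_cos_add_sub_le (a - Real.pi / 2) δ
  rwa [show a - Real.pi / 2 + δ = (a + δ) - Real.pi / 2 by ring, Real.cos_sub_pi_div_two,
    Real.cos_sub_pi_div_two, Real.sin_sub_pi_div_two, neg_mul, ← sub_eq_add_neg] at h

/-- Second order Taylor bound for the trigonometric kernel, with the increment `v - u` replaced by
an approximation `q`. -/
lemma abs_trig_sub_le (i : Fin 2) (u v q : ℝ) :
    |trig i v - trig i u - trigDeriv i u * q|
      ≤ 3 * (2 * Real.pi * (v - u)) ^ 2 + 2 * Real.pi * |v - u - q| := by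
  have h1 : |trig i v - trig i u - trigDeriv i u * (v - u)| ≤ 3 * (2 * Real.pi * (v - u)) ^ 2 := by
    have hv : 2 * Real.pi * v = 2 * Real.pi * u + 2 * Real.pi * (v - u) := by ring
    fin_cases i
    · have := abs_cos_add_sub_le (2 * Real.pi * u) (2 * Real.pi * (v - u))
      rw [← hv] at this
      convert this using 2
      simp [trig, trigDeriv]
      ring
    · have := abs_sin_add_sub_le (2 * Real.pi * u) (2 * Real.pi * (v - u))
      rw [← hv] at this
      convert this using 2
      simp [trig, trigDeriv]
      ring
  calc |trig i v - trig i u - trigDeriv i u * q|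
      = |(trig i v - trig i u - trigDeriv i u * (v - u)) + trigDeriv i u * (v - u - q)| := by
        ring_nf
    _ ≤ |trig i v - trig i u - trigDeriv i u * (v - u)| + |trigDeriv i u * (v - u - q)| :=
        abs_add_le _ _
    _ ≤ _ := by
        rw [abs_mul]
        gcongr
        exact abs_trigDeriv_le i u

end Trig

/-! ### Moments and joint measurability of the kernel `tau`. -/

section Model

variable {p : ℕ} {f : Vec p → ℝ → ℝ} {Θ : Set (Vec p)} {θ θ₀ : Vec p}

lemma tau_apply (f : Vec p → ℝ → ℝ) (θ : Vec p) (x : ℝ) (i : Fin 2) :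
    tau f θ x i = trig i (distFun f θ x) := by
  fin_cases i <;> rfl

lemma abs_tau_le_one (f : Vec p → ℝ → ℝ) (θ : Vec p) (x : ℝ) (i : Fin 2) : |tau f θ x i| ≤ 1 := by
  rw [tau_apply]
  exact abs_trig_le_one i _

namespace IsDensityFamily

variable (hf : IsDensityFamily f Θ)
include hf

lemma measurable_apply (θ : Vec p) : Measurable (f θ) :=
  hf.measurable.comp measurable_prodMk_left

lemma integrable (hθ : θ ∈ Θ) : Integrable (f θ) := by
  by_contra h
  have := hf.integral_eq_one θ hθ
  rw [integral_undef h] at this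
  exact zero_ne_one this

lemma isProbabilityMeasure_law (hθ : θ ∈ Θ) : IsProbabilityMeasure (law f θ) := by
  refine ⟨?_⟩
  rw [law, withDensity_apply _ MeasurableSet.univ, Measure.restrict_univ,
    ← ofReal_integral_eq_lintegral_ofReal (hf.integrable hθ)
      (Eventually.of_forall (hf.nonneg θ hθ)), hf.integral_eq_one θ hθ, ENNReal.ofReal_one]

lemma integral_law {E : Type*} [NormedAddCommGroup E] [NormedSpace ℝ E] (hθ : θ ∈ Θ) (g : ℝ → E) :
    ∫ x, g x ∂(law f θ) = ∫ x, f θ x • g x := by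
  rw [law, integral_withDensity_eq_integral_toReal_smul
    (hf.measurable_apply θ).ennreal_ofReal (by simp)]
  simp_rw [ENNReal.toReal_ofReal (hf.nonneg θ hθ _)]

lemma integrable_law_iff {E : Type*} [NormedAddCommGroup E] [NormedSpace ℝ E] (hθ : θ ∈ Θ)
    {g : ℝ → E} : Integrable g (law f θ) ↔ Integrable fun x => f θ x • g x := by
  rw [law, integrable_withDensity_iff_integrable_smul'
    (hf.measurable_apply θ).ennreal_ofReal (by simp)]
  simp_rw [ENNReal.toReal_ofReal (hf.nonneg θ hθ _)]

lemma distFun_eq_integral (hθ : θ ∈ Θ) (x : ℝ) : distFun f θ x = ∫ y in Set.Iic x, f θ y := by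
  rw [distFun, measureReal_def, law, withDensity_apply _ measurableSet_Iic,
    integral_eq_lintegral_of_nonneg_ae (Eventually.of_forall (hf.nonneg θ hθ))
      (hf.measurable_apply θ).aestronglyMeasurable]

lemma distFun_eq_cdf (hθ : θ ∈ Θ) : distFun f θ = cdf (law f θ) := by
  have := hf.isProbabilityMeasure_law hθ
  ext x
  rw [distFun, cdf_eq_real]

omit hf in
lemma continuous_integral_Iic {E : Type*} [NormedAddCommGroup E] [NormedSpace ℝ E] {g : ℝ → E}
    (hg : Integrable g) : Continuous fun x => ∫ y in Set.Iic x, g y := by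
  have h : (fun x => ∫ y in Set.Iic x, g y)
      = fun x => (∫ y in Set.Iic 0, g y) + ∫ y in (0 : ℝ)..x, g y := by
    ext x
    rw [← intervalIntegral.integral_Iic_sub_Iic hg.integrableOn hg.integrableOn]
    abel
  rw [h]
  exact continuous_const.add (hg.continuous_primitive 0)

lemma continuous_distFun (hθ : θ ∈ Θ) : Continuous (distFun f θ) := by
  rw [show distFun f θ = _ from funext (hf.distFun_eq_integral hθ)]
  exact continuous_integral_Iic (hf.integrable hθ)

lemma continuous_tau (hθ : θ ∈ Θ) (i : Fin 2) : Continuous fun x => tau f θ x i := by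
  simp_rw [tau_apply]
  exact (continuous_trig i).comp (hf.continuous_distFun hθ)

lemma integral_tau (hθ : θ ∈ Θ) (i : Fin 2) : ∫ x, tau f θ x i ∂(law f θ) = 0 := by
  have := hf.isProbabilityMeasure_law hθ
  have hc := hf.continuous_distFun hθ
  simp_rw [tau_apply]
  rw [hf.distFun_eq_cdf hθ] at *
  rw [integral_comp_cdf hc (continuous_trig i), integral_trig]

lemma integral_tau_mul_tau (hθ : θ ∈ Θ) (i j : Fin 2) :
    ∫ x, tau f θ x i * tau f θ x j ∂(law f θ)
      = (1 / 2 : ℝ) * (1 : Matrix (Fin 2) (Fin 2) ℝ) i j := by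
  have := hf.isProbabilityMeasure_law hθ
  have hc := hf.continuous_distFun hθ
  simp_rw [tau_apply]
  rw [hf.distFun_eq_cdf hθ] at *
  rw [integral_comp_cdf hc (φ := fun u => trig i u * trig j u)
    ((continuous_trig i).mul (continuous_trig j)), integral_trig_mul_trig]

/-- Joint measurability is needed because a random parameter is inserted. It follows from
measurability of integrals depending on a parameter, applied to the density times the indicator of y
≤ x. -/
lemma measurable_uncurry_distFun : Measurable (Function.uncurry (distFun f)) := by
  have h : Function.uncurry (distFun f) = fun z : Vec p × ℝ =>
      (∫⁻ y, (Set.Iic z.2).indicator (fun y => ENNReal.ofReal (f z.1 y)) y).toReal := by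
    ext z
    rw [Function.uncurry, distFun, measureReal_def, law, withDensity_apply _ measurableSet_Iic,
      lintegral_indicator measurableSet_Iic]
  rw [h]
  refine Measurable.ennreal_toReal (Measurable.lintegral_prod_right'
    (f := fun w : (Vec p × ℝ) × ℝ =>
      (Set.Iic w.1.2).indicator (fun y => ENNReal.ofReal (f w.1.1 y)) w.2) ?_)
  have h2 : (fun w : (Vec p × ℝ) × ℝ =>
      (Set.Iic w.1.2).indicator (fun y => ENNReal.ofReal (f w.1.1 y)) w.2)
      = {w : (Vec p × ℝ) × ℝ | w.2 ≤ w.1.2}.indicator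
        fun w => ENNReal.ofReal (Function.uncurry f (w.1.1, w.2)) := by
    ext w
    simp [Set.indicator_apply]
  rw [h2]
  refine Measurable.indicator ?_ (measurableSet_le measurable_snd measurable_fst.snd)
  exact (hf.measurable.comp (by fun_prop)).ennreal_ofReal

lemma measurable_uncurry_tau : Measurable (Function.uncurry (tau f)) := by
  have h (i : Fin 2) : Measurable fun z => trig i (Function.uncurry (distFun f) z) :=
    (continuous_trig i).measurable.comp hf.measurable_uncurry_distFun
  have h2 : Function.uncurry (tau f)
      = fun z => WithLp.toLp 2 fun i => trig i (Function.uncurry (distFun f) z) := by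
    ext z i
    exact tau_apply f z.1 z.2 i
  rw [h2]
  exact (WithLp.measurable_toLp 2 _).comp (measurable_pi_iff.2 h)

lemma aemeasurable_tau_comp {Ω : Type*} [MeasurableSpace Ω] {P : Measure Ω} {T : Ω → Vec p}
    {X : Ω → ℝ} (hT : AEMeasurable T P) (hX : AEMeasurable X P) :
    AEMeasurable (fun ω => tau f (T ω) (X ω)) P := by
  have h := hf.measurable_uncurry_tau.comp_aemeasurable (hT.prodMk hX)
  simpa only [Function.comp_def, Function.uncurry_apply_pair] using h

end IsDensityFamily

end Model

/-! ### Uniform differentiability of the kernel and the derivative of its mean. -/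

section Expansion

variable {p : ℕ} {f : Vec p → ℝ → ℝ} {Θ : Set (Vec p)} {θ θ₀ : Vec p}

/-- The first order remainder of `θ ↦ f(x | θ)` at `θ₀`. -/
noncomputable def densityRem (f : Vec p → ℝ → ℝ) (θ₀ θ : Vec p) (x : ℝ) : ℝ :=
  f θ x - f θ₀ x - inner ℝ (θ - θ₀) (score f θ₀ x) * f θ₀ x

/-- The derivative of `θ ↦ F(x | θ)` at `θ₀`. -/
noncomputable def distFunGrad (f : Vec p → ℝ → ℝ) (θ₀ : Vec p) (x : ℝ) : Vec p :=
  ∫ y in Set.Iic x, f θ₀ y • score f θ₀ y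

/-- The derivative of `θ ↦ τᵢ(x, θ)` at `θ₀`. -/
noncomputable def tauGrad (f : Vec p → ℝ → ℝ) (θ₀ : Vec p) (i : Fin 2) (x : ℝ) : Vec p :=
  trigDeriv i (distFun f θ₀ x) • distFunGrad f θ₀ x

/-- A bound for the entries of the derivative of `θ ↦ τ(x, θ)` at `θ₀`. -/
noncomputable def tauGradBound (f : Vec p → ℝ → ℝ) (θ₀ : Vec p) : ℝ :=
  2 * Real.pi * ∫ y, ‖f θ₀ y • score f θ₀ y‖

variable (hf : IsDensityFamily f Θ) (hθ₀ : θ₀ ∈ Θ) (hreg : DifferentiableInMeanAt f θ₀)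
include hf hθ₀ hreg

lemma integrable_smul_score : Integrable fun x => f θ₀ x • score f θ₀ x :=
  (hf.integrable_law_iff hθ₀).1 hreg.integrable_score

lemma integrable_densityRem (hθ : θ ∈ Θ) : Integrable (densityRem f θ₀ θ) := by
  have h := (integrable_smul_score hf hθ₀ hreg).const_inner (𝕜 := ℝ) (θ - θ₀)
  simp_rw [inner_smul_right, mul_comm (f θ₀ _)] at h
  exact ((hf.integrable hθ).sub (hf.integrable hθ₀)).sub h

lemma continuous_tauGrad (i : Fin 2) : Continuous (tauGrad f θ₀ i) :=
  ((continuous_trigDeriv i).comp (hf.continuous_distFun hθ₀)).smul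
    (IsDensityFamily.continuous_integral_Iic (integrable_smul_score hf hθ₀ hreg))

lemma norm_distFunGrad_le (x : ℝ) :
    ‖distFunGrad f θ₀ x‖ ≤ ∫ y, ‖f θ₀ y • score f θ₀ y‖ :=
  (norm_integral_le_integral_norm _).trans
    (setIntegral_le_integral (integrable_smul_score hf hθ₀ hreg).norm
      (Eventually.of_forall fun _ => norm_nonneg _))

lemma norm_tauGrad_le (i : Fin 2) (x : ℝ) : ‖tauGrad f θ₀ i x‖ ≤ tauGradBound f θ₀ := by
  rw [tauGrad, norm_smul, tauGradBound]
  gcongr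
  · exact abs_trigDeriv_le i _
  · exact norm_distFunGrad_le hf hθ₀ hreg x

/-- The left side is the integral of `densityRem` over a half line. The resulting bound does not
depend on `x`, which is what differentiability in mean provides. -/
lemma abs_distFun_sub_le (hθ : θ ∈ Θ) (x : ℝ) :
    |distFun f θ x - distFun f θ₀ x - inner ℝ (θ - θ₀) (distFunGrad f θ₀ x)|
      ≤ ∫ y, |densityRem f θ₀ θ y| := by
  have hs := integrable_smul_score hf hθ₀ hreg
  have h1 : distFun f θ x - distFun f θ₀ x - inner ℝ (θ - θ₀) (distFunGrad f θ₀ x)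
      = ∫ y in Set.Iic x, densityRem f θ₀ θ y := by
    rw [hf.distFun_eq_integral hθ, hf.distFun_eq_integral hθ₀, distFunGrad,
      ← integral_inner hs.integrableOn, ← integral_sub (hf.integrable hθ).integrableOn
        (hf.integrable hθ₀).integrableOn, ← integral_sub]
    · refine integral_congr_ae (Eventually.of_forall fun y => ?_)
      simp only [densityRem, inner_smul_right]
      ring
    · exact ((hf.integrable hθ).sub (hf.integrable hθ₀)).integrableOn
    · exact (hs.const_inner _).integrableOn
  rw [h1]
  have hi := (integrable_densityRem hf hθ₀ hreg hθ).norm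
  exact (norm_integral_le_integral_norm _).trans
    (setIntegral_le_integral hi (Eventually.of_forall fun _ => norm_nonneg _))

/-- The kernel `τ(x, ·)` is differentiable at `θ₀`, uniformly in `x`. -/
theorem exists_isLittleO_tau (hΘ : IsOpen Θ) : ∃ h : Vec p → ℝ,
    (h =o[𝓝 θ₀] fun θ => θ - θ₀) ∧ ∀ θ i x,
      |tau f θ x i - tau f θ₀ x i - inner ℝ (θ - θ₀) (tauGrad f θ₀ i x)| ≤ h θ := by
  classical
  set B := ∫ y, ‖f θ₀ y • score f θ₀ y‖ with hB
  set e : Vec p → ℝ := fun θ => ∫ y, |densityRem f θ₀ θ y| with he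
  have heo : e =o[𝓝 θ₀] fun θ => θ - θ₀ := hreg.isLittleO
  have hsub : Tendsto (fun θ : Vec p => θ - θ₀) (𝓝 θ₀) (𝓝 0) := by
    have : Continuous fun θ : Vec p => θ - θ₀ := by fun_prop
    simpa using this.tendsto θ₀
  have hl : (fun θ => e θ + ‖θ - θ₀‖ * B) =O[𝓝 θ₀] fun θ => θ - θ₀ := by
    refine heo.isBigO.add ?_
    simp_rw [mul_comm _ B]
    exact (isBigO_refl _ _).norm_left.const_mul_left B
  have hl0 : Tendsto (fun θ => e θ + ‖θ - θ₀‖ * B) (𝓝 θ₀) (𝓝 0) := hl.trans_tendsto hsub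
  have hsq : (fun θ => (e θ + ‖θ - θ₀‖ * B) ^ 2) =o[𝓝 θ₀] fun θ => θ - θ₀ := by
    have := hl.norm_right.mul_isLittleO ((isLittleO_one_iff ℝ).2 hl0)
    simp_rw [mul_one, ← sq] at this
    exact this.of_norm_right
  -- The bound must hold for every θ, as an estimator may leave `Θ`. Outside, where the densities
  -- are arbitrary, boundedness of `tau` and of its gradient suffices; openness of `Θ` makes this
  -- branch irrelevant near `θ₀`.
  refine ⟨fun θ => if θ ∈ Θ then 3 * (2 * Real.pi) ^ 2 * (e θ + ‖θ - θ₀‖ * B) ^ 2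
    + 2 * Real.pi * e θ else 2 + ‖θ - θ₀‖ * tauGradBound f θ₀, ?_, fun θ i x => ?_⟩
  · refine ((hsq.const_mul_left (3 * (2 * Real.pi) ^ 2)).add
      (heo.const_mul_left (2 * Real.pi))).congr' ?_ EventuallyEq.rfl
    filter_upwards [hΘ.mem_nhds hθ₀] with θ hθ
    rw [if_pos hθ]
  · simp only []
    split_ifs with hθ
    · have h1 := abs_distFun_sub_le hf hθ₀ hreg hθ x
      have h2 : |distFun f θ x - distFun f θ₀ x| ≤ e θ + ‖θ - θ₀‖ * B := by
        have h3 : |inner ℝ (θ - θ₀) (distFunGrad f θ₀ x)| ≤ ‖θ - θ₀‖ * B :=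
          (abs_real_inner_le_norm _ _).trans
            (mul_le_mul_of_nonneg_left (norm_distFunGrad_le hf hθ₀ hreg x) (norm_nonneg _))
        calc |distFun f θ x - distFun f θ₀ x|
            = |(distFun f θ x - distFun f θ₀ x - inner ℝ (θ - θ₀) (distFunGrad f θ₀ x))
              + inner ℝ (θ - θ₀) (distFunGrad f θ₀ x)| := by ring_nf
          _ ≤ _ := (abs_add_le _ _).trans (add_le_add h1 h3)
      have h4 := abs_trig_sub_le i (distFun f θ₀ x) (distFun f θ x)
        (inner ℝ (θ - θ₀) (distFunGrad f θ₀ x))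
      rw [tau_apply, tau_apply, tauGrad, inner_smul_right]
      refine h4.trans ?_
      rw [mul_pow, ← mul_assoc, ← sq_abs (distFun f θ x - distFun f θ₀ x)]
      have hp := Real.pi_pos
      gcongr
    · have h1 : |inner ℝ (θ - θ₀) (tauGrad f θ₀ i x)| ≤ ‖θ - θ₀‖ * tauGradBound f θ₀ :=
        (abs_real_inner_le_norm _ _).trans
          (mul_le_mul_of_nonneg_left (norm_tauGrad_le hf hθ₀ hreg i x) (norm_nonneg _))
      have h2 := abs_tau_le_one f θ x i
      have h3 := abs_tau_le_one f θ₀ x i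
      calc _ ≤ |tau f θ x i - tau f θ₀ x i| + |inner ℝ (θ - θ₀) (tauGrad f θ₀ i x)| := abs_sub _ _
        _ ≤ (|tau f θ x i| + |tau f θ₀ x i|) + |inner ℝ (θ - θ₀) (tauGrad f θ₀ i x)| := by
          gcongr; exact abs_sub _ _
        _ ≤ _ := by linarith

-- Uniqueness of the Fréchet derivative: a linear functional that is of smaller order than its
-- argument is zero.
omit hf hθ₀ hreg in
lemma eq_zero_of_inner_isLittleO {E : Type*} [NormedAddCommGroup E] [InnerProductSpace ℝ E]
    {m a : E} (h : (fun θ => inner ℝ (θ - a) m) =o[𝓝 a] fun θ => θ - a) : m = 0 := by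
  have h1 : HasFDerivAt (fun θ => inner ℝ (θ - a) m) (0 : E →L[ℝ] ℝ) a := by
    rw [hasFDerivAt_iff_isLittleO]
    simpa using h
  have h2 : HasFDerivAt (fun θ => inner ℝ (θ - a) m) (innerSL ℝ m) a := by
    rw [hasFDerivAt_iff_isLittleO]
    simp [real_inner_comm]
  have h3 := DFunLike.congr_fun (h1.unique h2) m
  simpa using h3.symm

lemma integrable_tau_smul_score (i : Fin 2) :
    Integrable (fun x => tau f θ₀ x i • score f θ₀ x) (law f θ₀) := by
  have hm : AEStronglyMeasurable (fun x => tau f θ₀ x i) (law f θ₀) :=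
    (hf.continuous_tau hθ₀ i).aestronglyMeasurable
  have hb : ∀ᵐ x ∂(law f θ₀), ‖tau f θ₀ x i‖ ≤ 1 :=
    Eventually.of_forall fun x => abs_tau_le_one f θ₀ x i
  refine hreg.integrable_score.norm.mono' (hm.smul hreg.integrable_score.1) ?_
  filter_upwards [hb] with x hx
  rw [norm_smul]
  exact mul_le_of_le_one_left (norm_nonneg _) hx

lemma integrable_tauGrad (i : Fin 2) : Integrable (tauGrad f θ₀ i) (law f θ₀) := by
  have := hf.isProbabilityMeasure_law hθ₀
  have hm : AEStronglyMeasurable (tauGrad f θ₀ i) (law f θ₀) :=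
    (continuous_tauGrad hf hθ₀ hreg i).aestronglyMeasurable
  exact Integrable.of_bound hm (tauGradBound f θ₀)
    (Eventually.of_forall fun x => norm_tauGrad_le hf hθ₀ hreg i x)

/-- Differentiating the identity `E_θ τ(X, θ) = 0` at `θ₀`. -/
theorem integral_tauGrad (hΘ : IsOpen Θ) (i : Fin 2) :
    ∫ x, tauGrad f θ₀ i x ∂(law f θ₀) + ∫ x, tau f θ₀ x i • score f θ₀ x ∂(law f θ₀) = 0 := by
  obtain ⟨h, hho, hh⟩ := exists_isLittleO_tau hf hθ₀ hreg hΘ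
  set S := ∫ y, ‖f θ₀ y • score f θ₀ y‖ with hS
  set C := tauGradBound f θ₀ with hC
  have hsub : Tendsto (fun θ : Vec p => θ - θ₀) (𝓝 θ₀) (𝓝 0) := by
    have : Continuous fun θ : Vec p => θ - θ₀ := by fun_prop
    simpa using this.tendsto θ₀
  have hn0 : Tendsto (fun θ => (h θ + C * ‖θ - θ₀‖) * S) (𝓝 θ₀) (𝓝 0) := by
    have := ((hho.isBigO.trans_tendsto hsub).add (hsub.norm.const_mul C)).mul_const S
    simpa using this
  have hbound : (fun θ => h θ + (∫ y, |densityRem f θ₀ θ y|)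
      + ‖θ - θ₀‖ * ((h θ + C * ‖θ - θ₀‖) * S)) =o[𝓝 θ₀] fun θ => θ - θ₀ := by
    refine (hho.add hreg.isLittleO).add ?_
    have := ((isBigO_refl (fun θ : Vec p => θ - θ₀) (𝓝 θ₀)).norm_norm).mul_isLittleO
      ((isLittleO_one_iff ℝ).2 hn0)
    simp_rw [mul_one] at this
    exact this.of_norm_right
  -- The vector is the derivative of θ ↦ E_θ τ(X, θ), a function that vanishes on `Θ`; it is enough
  -- to bound the first order error of the product f · τ.
  refine eq_zero_of_inner_isLittleO (a := θ₀) (IsBigO.trans_isLittleO ?_ hbound)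
  refine IsBigO.of_bound 1 ?_
  filter_upwards [hΘ.mem_nhds hθ₀] with θ hθ
  have hp0 := hf.isProbabilityMeasure_law hθ₀
  have hgs := integrable_smul_score hf hθ₀ hreg
  have it : Integrable fun x => f θ x * tau f θ x i :=
    (hf.integrable hθ).mul_bdd (c := 1) (hf.continuous_tau hθ i).aestronglyMeasurable
      (Eventually.of_forall fun x => abs_tau_le_one f θ x i)
  have it0 : Integrable fun x => f θ₀ x * tau f θ₀ x i :=
    (hf.integrable hθ₀).mul_bdd (c := 1) (hf.continuous_tau hθ₀ i).aestronglyMeasurable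
      (Eventually.of_forall fun x => abs_tau_le_one f θ₀ x i)
  have e1 : ∫ x, f θ x * tau f θ x i = 0 := by
    rw [← hf.integral_tau hθ i, hf.integral_law hθ]; rfl
  have e0 : ∫ x, f θ₀ x * tau f θ₀ x i = 0 := by
    rw [← hf.integral_tau hθ₀ i, hf.integral_law hθ₀]; rfl
  have i2 : Integrable fun x => f θ₀ x • (tauGrad f θ₀ i x + tau f θ₀ x i • score f θ₀ x) :=
    (hf.integrable_law_iff hθ₀).1
      ((integrable_tauGrad hf hθ₀ hreg i).add (integrable_tau_smul_score hf hθ₀ hreg i))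
  have e2 : inner ℝ (θ - θ₀) (∫ x, tauGrad f θ₀ i x ∂(law f θ₀)
      + ∫ x, tau f θ₀ x i • score f θ₀ x ∂(law f θ₀))
      = ∫ x, inner ℝ (θ - θ₀) (f θ₀ x • (tauGrad f θ₀ i x + tau f θ₀ x i • score f θ₀ x)) := by
    rw [← integral_add (integrable_tauGrad hf hθ₀ hreg i)
      (integrable_tau_smul_score hf hθ₀ hreg i), hf.integral_law hθ₀, integral_inner i2]
  have e3 : -inner ℝ (θ - θ₀) (∫ x, tauGrad f θ₀ i x ∂(law f θ₀)
      + ∫ x, tau f θ₀ x i • score f θ₀ x ∂(law f θ₀))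
      = ∫ x, (f θ x * tau f θ x i - f θ₀ x * tau f θ₀ x i
        - inner ℝ (θ - θ₀) (f θ₀ x • (tauGrad f θ₀ i x + tau f θ₀ x i • score f θ₀ x))) := by
    have itd : Integrable fun x => f θ x * tau f θ x i - f θ₀ x * tau f θ₀ x i := it.sub it0
    rw [integral_sub itd (i2.const_inner _), integral_sub it it0, e1, e0, e2]
    ring
  have hrem := integrable_densityRem hf hθ₀ hreg hθ
  have ibd₁ : Integrable fun x => h θ * f θ₀ x + |densityRem f θ₀ θ x| :=
    ((hf.integrable hθ₀).const_mul _).add hrem.abs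
  have ibd : Integrable fun x => h θ * f θ₀ x + |densityRem f θ₀ θ x|
      + ‖θ - θ₀‖ * (h θ + C * ‖θ - θ₀‖) * ‖f θ₀ x • score f θ₀ x‖ :=
    ibd₁.add (hgs.norm.const_mul _)
  have hle : ‖inner ℝ (θ - θ₀) (∫ x, tauGrad f θ₀ i x ∂(law f θ₀)
      + ∫ x, tau f θ₀ x i • score f θ₀ x ∂(law f θ₀))‖
      ≤ ∫ x, (h θ * f θ₀ x + |densityRem f θ₀ θ x|
        + ‖θ - θ₀‖ * (h θ + C * ‖θ - θ₀‖) * ‖f θ₀ x • score f θ₀ x‖) := by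
    rw [← norm_neg, e3]
    refine norm_integral_le_of_norm_le ibd (Eventually.of_forall fun x => ?_)
    set q := inner ℝ (θ - θ₀) (score f θ₀ x) with hq
    set d := inner ℝ (θ - θ₀) (tauGrad f θ₀ i x) with hd
    have hr := hh θ i x
    rw [← hd] at hr
    have hdle : |d| ≤ C * ‖θ - θ₀‖ := by
      rw [mul_comm]
      exact (abs_real_inner_le_norm _ _).trans
        (mul_le_mul_of_nonneg_left (norm_tauGrad_le hf hθ₀ hreg i x) (norm_nonneg _))
    have hdiff : |tau f θ x i - tau f θ₀ x i| ≤ h θ + C * ‖θ - θ₀‖ := by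
      calc |tau f θ x i - tau f θ₀ x i| = |(tau f θ x i - tau f θ₀ x i - d) + d| := by ring_nf
        _ ≤ _ := (abs_add_le _ _).trans (add_le_add hr hdle)
    have hqle : |f θ₀ x * q| ≤ ‖θ - θ₀‖ * ‖f θ₀ x • score f θ₀ x‖ := by
      rw [hq, ← inner_smul_right]
      exact abs_real_inner_le_norm _ _
    -- Product rule with remainder: the kernel remainder, the density remainder times a bounded
    -- factor, and a cross term of two first order increments.
    have hid : f θ x * tau f θ x i - f θ₀ x * tau f θ₀ x i
        - inner ℝ (θ - θ₀) (f θ₀ x • (tauGrad f θ₀ i x + tau f θ₀ x i • score f θ₀ x))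
        = (tau f θ x i - tau f θ₀ x i - d) * f θ₀ x + tau f θ x i * densityRem f θ₀ θ x
          + (tau f θ x i - tau f θ₀ x i) * (f θ₀ x * q) := by
      rw [inner_smul_right, inner_add_right, inner_smul_right, ← hq, ← hd, densityRem, ← hq]
      ring
    rw [hid, Real.norm_eq_abs]
    refine (abs_add_le _ _).trans (add_le_add ((abs_add_le _ _).trans (add_le_add ?_ ?_)) ?_)
    · rw [abs_mul, abs_of_nonneg (hf.nonneg θ₀ hθ₀ x)]
      exact mul_le_mul_of_nonneg_right hr (hf.nonneg θ₀ hθ₀ x)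
    · rw [abs_mul]
      exact mul_le_of_le_one_left (abs_nonneg _) (abs_tau_le_one f θ x i)
    · rw [abs_mul]
      calc |tau f θ x i - tau f θ₀ x i| * |f θ₀ x * q|
          ≤ (h θ + C * ‖θ - θ₀‖) * (‖θ - θ₀‖ * ‖f θ₀ x • score f θ₀ x‖) := by
            gcongr
            exact (abs_nonneg _).trans hdiff
        _ = _ := by ring
  rw [one_mul]
  refine hle.trans (le_trans (le_of_eq ?_) (le_abs_self _))
  rw [integral_add ibd₁ (hgs.norm.const_mul _),
    integral_add ((hf.integrable hθ₀).const_mul _) hrem.abs, integral_const_mul,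
    integral_const_mul, hf.integral_eq_one θ₀ hθ₀]
  ring

end Expansion

/-! ### The influence function and its covariance. -/

section Covariance

variable {p : ℕ} {f : Vec p → ℝ → ℝ} {r : Vec p → ℝ → Vec p} {Θ : Set (Vec p)} {θ₀ : Vec p}

lemma matR_isSymm (f : Vec p → ℝ → ℝ) (r : Vec p → ℝ → Vec p) (θ : Vec p) :
    (matR f r θ).IsSymm := by
  ext i j
  simp [matR, mul_comm]

lemma sigma_isSymm (f : Vec p → ℝ → ℝ) (r : Vec p → ℝ → Vec p) (θ : Vec p) :
    (sigma f r θ).IsSymm := by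
  have hR : ((matR f r θ)⁻¹)ᵀ = (matR f r θ)⁻¹ := by
    rw [Matrix.transpose_nonsing_inv, (matR_isSymm f r θ).eq]
  rw [Matrix.IsSymm, sigma]
  simp only [Matrix.transpose_add, Matrix.transpose_sub, Matrix.transpose_smul,
    Matrix.transpose_one, Matrix.transpose_mul, Matrix.transpose_transpose, hR, Matrix.mul_assoc]
  abel

/-- The `i`-th row of `G_θ`, as a vector. -/
noncomputable def rowG (f : Vec p → ℝ → ℝ) (θ : Vec p) (i : Fin 2) : Vec p :=
  ∫ x, tau f θ x i • score f θ x ∂(law f θ)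

/-- The influence function `τ(x, θ) - G_θ R_θ⁻¹ r(x, θ)` of `τ̄ₙ(θ̂ₙ)`. -/
noncomputable def infl (f : Vec p → ℝ → ℝ) (r : Vec p → ℝ → Vec p) (θ : Vec p) (x : ℝ) : Vec 2 :=
  WithLp.toLp 2 fun i => tau f θ x i
    - inner ℝ (rowG f θ i) (Matrix.toEuclideanCLM (𝕜 := ℝ) (matR f r θ)⁻¹ (r θ x))

lemma infl_apply (f : Vec p → ℝ → ℝ) (r : Vec p → ℝ → Vec p) (θ : Vec p) (x : ℝ) (i : Fin 2) :
    infl f r θ x i = tau f θ x i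
      - inner ℝ (rowG f θ i) (Matrix.toEuclideanCLM (𝕜 := ℝ) (matR f r θ)⁻¹ (r θ x)) := rfl

variable (hf : IsDensityFamily f Θ) (hθ₀ : θ₀ ∈ Θ)
include hf hθ₀

lemma memLp_tau (i : Fin 2) : MemLp (fun x => tau f θ₀ x i) 2 (law f θ₀) := by
  have := hf.isProbabilityMeasure_law hθ₀
  have hm : AEStronglyMeasurable (fun x => tau f θ₀ x i) (law f θ₀) :=
    (hf.continuous_tau hθ₀ i).aestronglyMeasurable
  exact MemLp.of_bound hm 1 (Eventually.of_forall fun x => abs_tau_le_one f θ₀ x i)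

lemma memLp_infl (hr : MemLp (r θ₀) 2 (law f θ₀)) : MemLp (infl f r θ₀) 2 (law f θ₀) :=
  MemLp.of_eval_piLp fun i => (memLp_tau hf hθ₀ i).sub
    (((Matrix.toEuclideanCLM (𝕜 := ℝ) (matR f r θ₀)⁻¹).comp_memLp' hr).const_inner _)

lemma integral_infl (hr : MemLp (r θ₀) 2 (law f θ₀)) (h0 : ∫ x, r θ₀ x ∂(law f θ₀) = 0) :
    ∫ x, infl f r θ₀ x ∂(law f θ₀) = 0 := by
  have := hf.isProbabilityMeasure_law hθ₀
  have hri : Integrable (r θ₀) (law f θ₀) := hr.integrable one_le_two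
  have hLr := (Matrix.toEuclideanCLM (𝕜 := ℝ) (matR f r θ₀)⁻¹).integrable_comp hri
  ext i
  rw [eval_integral_piLp fun i => ((memLp_infl hf hθ₀ hr).eval_piLp i).integrable one_le_two]
  simp_rw [infl_apply]
  rw [integral_sub ((memLp_tau hf hθ₀ i).integrable one_le_two) (hLr.const_inner _),
    hf.integral_tau hθ₀, integral_inner hLr, ContinuousLinearMap.integral_comp_comm _ hri, h0]
  simp

/-- With B = G R⁻¹, the second moment of τ - B r expands to ½ I - B Jᵀ - J Bᵀ + B R Bᵀ, and B R Bᵀ =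
G R⁻¹ Gᵀ since R is symmetric and invertible. -/
lemma sigma_eq_integral (hreg : DifferentiableInMeanAt f θ₀) (hr : MemLp (r θ₀) 2 (law f θ₀))
    (hR : (matR f r θ₀).PosDef) (i j : Fin 2) :
    sigma f r θ₀ i j = ∫ x, infl f r θ₀ x i * infl f r θ₀ x j ∂(law f θ₀) := by
  have hrow : ∀ i k, rowG f θ₀ i k = matG f θ₀ i k := fun i k => by
    have hint := integrable_tau_smul_score hf hθ₀ hreg i
    have h2 := (EuclideanSpace.proj (𝕜 := ℝ) k).integral_comp_comm hint
    rw [rowG, matG, Matrix.of_apply]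
    exact h2.symm
  set B := matG f θ₀ * (matR f r θ₀)⁻¹ with hB
  have hinfl : ∀ x i, infl f r θ₀ x i = tau f θ₀ x i - ∑ k, B i k * r θ₀ x k := by
    intro x i
    have hrow' : (rowG f θ₀ i).ofLp = matG f θ₀ i := funext (hrow i)
    rw [infl_apply, Matrix.inner_toEuclideanCLM, hrow', hB]
    have := congrFun (Matrix.mulVec_mulVec (r θ₀ x).ofLp (matG f θ₀) (matR f r θ₀)⁻¹) i
    simp only [Matrix.mulVec, dotProduct] at this ⊢
    rw [this]
  have hτ := memLp_tau hf hθ₀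
  have hrk : ∀ k, MemLp (fun x => r θ₀ x k) 2 (law f θ₀) := hr.eval_piLp
  have iττ : Integrable (fun x => tau f θ₀ x i * tau f θ₀ x j) (law f θ₀) :=
    (hτ i).integrable_mul (hτ j)
  have iτr : ∀ i k, Integrable (fun x => tau f θ₀ x i * r θ₀ x k) (law f θ₀) := fun i k =>
    (hτ i).integrable_mul (hrk k)
  have irr : ∀ k l, Integrable (fun x => r θ₀ x k * r θ₀ x l) (law f θ₀) := fun k l =>
    (hrk k).integrable_mul (hrk l)
  have iB : ∀ a b : Fin 2, Integrable (fun x => ∑ k, B a k * (tau f θ₀ x b * r θ₀ x k))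
      (law f θ₀) := fun a b => integrable_finsetSum _ fun k _ => (iτr b k).const_mul _
  have iBB : Integrable (fun x => ∑ k, ∑ l, B i k * B j l * (r θ₀ x k * r θ₀ x l)) (law f θ₀) :=
    integrable_finsetSum _ fun k _ => integrable_finsetSum _ fun l _ => (irr k l).const_mul _
  have hprod : ∀ x, infl f r θ₀ x i * infl f r θ₀ x j
      = tau f θ₀ x i * tau f θ₀ x j - ∑ k, B i k * (tau f θ₀ x j * r θ₀ x k)
        - ∑ k, B j k * (tau f θ₀ x i * r θ₀ x k)
        + ∑ k, ∑ l, B i k * B j l * (r θ₀ x k * r θ₀ x l) := by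
    intro x
    have e1 : ∀ a b : Fin 2, ∑ k, B a k * (tau f θ₀ x b * r θ₀ x k)
        = tau f θ₀ x b * ∑ k, B a k * r θ₀ x k := fun a b => by
      rw [Finset.mul_sum]
      exact Finset.sum_congr rfl fun k _ => by ring
    have e2 : ∑ k, ∑ l, B i k * B j l * (r θ₀ x k * r θ₀ x l)
        = (∑ k, B i k * r θ₀ x k) * ∑ l, B j l * r θ₀ x l := by
      rw [Finset.sum_mul_sum]
      exact Finset.sum_congr rfl fun k _ => Finset.sum_congr rfl fun l _ => by ring
    rw [hinfl, hinfl, e1, e1, e2]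
    ring
  have hJ : ∀ a b : Fin 2, ∫ x, ∑ k, B a k * (tau f θ₀ x b * r θ₀ x k) ∂(law f θ₀)
      = (B * (matJ f r θ₀)ᵀ) a b := fun a b => by
    rw [integral_finsetSum _ fun k _ => (iτr b k).const_mul _, Matrix.mul_apply]
    simp_rw [integral_const_mul]
    rfl
  have hRR : ∫ x, ∑ k, ∑ l, B i k * B j l * (r θ₀ x k * r θ₀ x l) ∂(law f θ₀)
      = (B * matR f r θ₀ * Bᵀ) i j := by
    rw [integral_finsetSum _ fun k _ => integrable_finsetSum _ fun l _ => (irr k l).const_mul _,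
      Matrix.mul_assoc, Matrix.mul_apply]
    refine Finset.sum_congr rfl fun k _ => ?_
    rw [integral_finsetSum _ fun l _ => (irr k l).const_mul _, Matrix.mul_apply, Finset.mul_sum]
    refine Finset.sum_congr rfl fun l _ => ?_
    rw [integral_const_mul, Matrix.transpose_apply, matR, Matrix.of_apply]
    ring
  simp_rw [hprod]
  have i1 : Integrable (fun x => tau f θ₀ x i * tau f θ₀ x j
      - ∑ k, B i k * (tau f θ₀ x j * r θ₀ x k)) (law f θ₀) := iττ.sub (iB i j)
  have i2 : Integrable (fun x => tau f θ₀ x i * tau f θ₀ x j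
      - ∑ k, B i k * (tau f θ₀ x j * r θ₀ x k)
      - ∑ k, B j k * (tau f θ₀ x i * r θ₀ x k)) (law f θ₀) := i1.sub (iB j i)
  rw [integral_add i2 iBB, integral_sub i1 (iB j i), integral_sub iττ (iB i j),
    hf.integral_tau_mul_tau hθ₀, hJ, hJ, hRR]
  have hRi : ((matR f r θ₀)⁻¹)ᵀ = (matR f r θ₀)⁻¹ := by
    rw [Matrix.transpose_nonsing_inv, (matR_isSymm f r θ₀).eq]
  have hdet : IsUnit (matR f r θ₀).det := isUnit_iff_ne_zero.2 hR.det_pos.ne'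
  have hBR : B * matR f r θ₀ * Bᵀ = matG f θ₀ * (matR f r θ₀)⁻¹ * (matG f θ₀)ᵀ := by
    rw [hB, Matrix.mul_assoc (matG f θ₀), Matrix.nonsing_inv_mul _ hdet, Matrix.mul_one,
      Matrix.transpose_mul, hRi, Matrix.mul_assoc]
  have hJB : (B * (matJ f r θ₀)ᵀ) j i
      = (matJ f r θ₀ * (matR f r θ₀)⁻¹ * (matG f θ₀)ᵀ) i j := by
    rw [← Matrix.transpose_apply (B * (matJ f r θ₀)ᵀ), Matrix.transpose_mul,
      Matrix.transpose_transpose, hB, Matrix.transpose_mul, hRi, Matrix.mul_assoc]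
  rw [hBR, hJB, sigma]
  rfl

end Covariance

/-! ### Limit theorems for functions of an i.i.d. sample. -/

section IID

variable {Ω : Type*} [MeasurableSpace Ω] {P : Measure Ω} {X : ℕ → Ω → ℝ} {ν : Measure ℝ}
  {E : Type*} [MeasurableSpace E] {g : ℝ → E}

lemma iIndepFun_comp_of_hasLaw (hX : ∀ i, HasLaw (X i) ν P) (hindep : iIndepFun X P)
    (hg : AEMeasurable g ν) : iIndepFun (fun i ω => g (X i ω)) P :=
  hindep.comp₀ (fun _ => g) (fun i => (hX i).aemeasurable) fun i => by rwa [(hX i).map_eq]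

lemma identDistrib_comp_of_hasLaw (hX : ∀ i, HasLaw (X i) ν P) (hg : AEMeasurable g ν) (i : ℕ) :
    IdentDistrib (fun ω => g (X i ω)) (fun ω => g (X 0 ω)) P P :=
  IdentDistrib.comp_of_aemeasurable (u := g)
    ⟨(hX i).aemeasurable, (hX 0).aemeasurable, (hX i).map_eq.trans (hX 0).map_eq.symm⟩
    (by rwa [(hX i).map_eq])

/-- The multivariate central limit theorem for functions of an i.i.d. sample. -/
lemma tendstoInDistribution_of_hasLaw [IsProbabilityMeasure P] {ι : Type*} [Fintype ι]
    [DecidableEq ι] {g : ℝ → EuclideanSpace ℝ ι} (hX : ∀ i, HasLaw (X i) ν P)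
    (hindep : iIndepFun X P) (hg : MemLp g 2 ν) (h0 : ∫ x, g x ∂ν = 0) {S : Matrix ι ι ℝ}
    (hS : ∀ i j, S i j = ∫ x, g x i * g x j ∂ν) :
    TendstoInDistribution
      (fun (n : ℕ) ω => (√(n : ℝ))⁻¹ • ∑ k ∈ Finset.range n, g (X k ω)) atTop
      (id : EuclideanSpace ℝ ι → _) (fun _ => P) (multivariateGaussian 0 S) := by
  have hm := hg.aestronglyMeasurable.aemeasurable
  refine tendstoInDistribution_multivariate (iIndepFun_comp_of_hasLaw hX hindep hm)
    (identDistrib_comp_of_hasLaw hX hm) ?_ ?_ fun i j => ?_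
  · have hg' : MemLp g 2 (P.map (X 0)) := by rwa [(hX 0).map_eq]
    exact hg'.comp_of_map (hX 0).aemeasurable
  · exact ((hX 0).integral_comp hg.aestronglyMeasurable).trans h0
  · rw [hS]
    exact ((hX 0).integral_comp (f := fun x => g x i * g x j)
      ((hg.eval_piLp i).aestronglyMeasurable.mul (hg.eval_piLp j).aestronglyMeasurable)).symm

/-- The weak law of large numbers for functions of an i.i.d. sample. -/
lemma tendstoInMeasure_average_of_hasLaw [IsProbabilityMeasure P] {E : Type*}
    [NormedAddCommGroup E] [NormedSpace ℝ E] [CompleteSpace E] [MeasurableSpace E] [BorelSpace E]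
    [SecondCountableTopology E] {g : ℝ → E} (hX : ∀ i, HasLaw (X i) ν P) (hindep : iIndepFun X P)
    (hg : Integrable g ν) :
    TendstoInMeasure P (fun (n : ℕ) ω => (n : ℝ)⁻¹ • ∑ k ∈ Finset.range n, g (X k ω)) atTop
      (fun _ => ∫ x, g x ∂ν) := by
  have hm := hg.aestronglyMeasurable.aemeasurable
  have hid := identDistrib_comp_of_hasLaw hX hm
  have hind := iIndepFun_comp_of_hasLaw hX hindep hm
  have hg' : Integrable g (P.map (X 0)) := by rwa [(hX 0).map_eq]
  have hlim := strong_law_ae (fun i ω => g (X i ω)) (hg'.comp_aemeasurable (hX 0).aemeasurable)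
    (fun i j hij => hind.indepFun hij) hid
  refine tendstoInMeasure_of_tendsto_ae (fun n => ?_) ?_
  · exact ((Finset.aemeasurable_fun_sum (Finset.range n)
      fun k _ => (hid k).aemeasurable_fst).fun_const_smul _).aestronglyMeasurable
  · filter_upwards [hlim] with ω hω
    rwa [show ∫ ω, g (X 0 ω) ∂P = ∫ x, g x ∂ν from
      (hX 0).integral_comp hg.aestronglyMeasurable] at hω

end IID

/-! ### Standardization of the Gaussian limit. -/

section Limit

lemma map_multivariateGaussian_invSqrt {A : Matrix (Fin 2) (Fin 2) ℝ} (hp : A.PosSemidef)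
    (hd : A.det ≠ 0) :
    (multivariateGaussian 0 A).map (Matrix.toEuclideanCLM (𝕜 := ℝ) (invSqrt A))
      = multivariateGaussian 0 1 := by
  rw [multivariateGaussian_zero_one, multivariateGaussian,
    Measure.map_map (by fun_prop) (by fun_prop)]
  convert Measure.map_id
  ext x
  simp only [Function.comp_apply, zero_add, id]
  rw [← mul_apply_eq_comp, ← map_mul, invSqrt_mul_sqrt hp hd, map_one]
  rfl

lemma map_stdGaussian_sum_sq :
    (stdGaussian (EuclideanSpace ℝ (Fin 2))).map (fun z => ∑ i, z i ^ 2) = chiSquared 2 := by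
  rw [← map_pi_eq_stdGaussian, Measure.map_map (by fun_prop) (by fun_prop)]
  rfl

/-- The Gaussian is the image of a standard one under the symmetric root S of A, and S A⁻¹ S = 1
reduces the quadratic form to a sum of squares. -/
lemma map_multivariateGaussian_dotProduct_inv {A : Matrix (Fin 2) (Fin 2) ℝ} (hp : A.PosSemidef)
    (hd : A.det ≠ 0) :
    (multivariateGaussian 0 A).map (fun z => z.ofLp ⬝ᵥ (A⁻¹ *ᵥ z.ofLp)) = chiSquared 2 := by
  have hm : Measurable fun z : Vec 2 => z.ofLp ⬝ᵥ (A⁻¹ *ᵥ z.ofLp) := by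
    simp only [dotProduct, Matrix.mulVec]
    fun_prop
  rw [← map_stdGaussian_sum_sq, multivariateGaussian, Measure.map_map hm (by fun_prop)]
  congr 1
  ext x
  have hs : (CFC.sqrt A)ᵀ = CFC.sqrt A :=
    (Matrix.nonneg_iff_posSemidef.1 (CFC.sqrt_nonneg A)).isHermitian
  have hsq : CFC.sqrt A * CFC.sqrt A = A := CFC.sqrt_mul_sqrt_self A hp.nonneg
  have hu : IsUnit (CFC.sqrt A).det := by
    refine isUnit_iff_ne_zero.2 fun h => hd ?_
    rw [← hsq, Matrix.det_mul, h, mul_zero]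
  have hone : CFC.sqrt A * A⁻¹ * CFC.sqrt A = 1 := by
    have hinv : A⁻¹ = (CFC.sqrt A)⁻¹ * (CFC.sqrt A)⁻¹ := by
      rw [← Matrix.mul_inv_rev, hsq]
    rw [hinv, Matrix.mul_nonsing_inv_cancel_left _ _ hu, Matrix.nonsing_inv_mul _ hu]
  simp only [Function.comp_apply, zero_add, Matrix.ofLp_toEuclideanCLM]
  rw [dotProduct_comm, Matrix.dotProduct_mulVec, ← Matrix.mulVec_transpose, hs,
    Matrix.mulVec_mulVec, Matrix.mulVec_mulVec, hone, Matrix.one_mulVec, dotProduct]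
  simp_rw [sq]

end Limit

/-! ### Asymptotic linearity and the limit laws. -/

section Main

variable {Ω : Type*} [MeasurableSpace Ω] {P : Measure Ω} [IsProbabilityMeasure P]
  {p : ℕ} {Θ : Set (Vec p)} {f : Vec p → ℝ → ℝ} {r : Vec p → ℝ → Vec p} {θ₀ : Vec p}
  {X : ℕ → Ω → ℝ} {est : (n : ℕ) → (Fin n → ℝ) → Vec p}

/-- An estimator with a linear representation is `√n`-consistent. -/
lemma boundedInProb_sqrt_smul_est_sub (hXlaw : ∀ i, HasLaw (X i) (law f θ₀) P)
    (hXindep : iIndepFun X P) (hrep : HasLinearRepresentation P X f r est θ₀) :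
    BoundedInProb P fun (n : ℕ) ω => √(n : ℝ) • (est n (fun i => X i ω) - θ₀) := by
  have hclt := tendstoInDistribution_of_hasLaw hXlaw hXindep hrep.memLp hrep.integral_eq_zero
    (S := matR f r θ₀) fun i j => rfl
  have hL := hclt.continuous_comp (Matrix.toEuclideanCLM (𝕜 := ℝ) (matR f r θ₀)⁻¹).continuous
  exact (TendstoInDistribution.boundedInProb hL).of_sub hrep.tendsto

/-- The sample trigonometric moments with estimated parameters are asymptotically linear, with
influence function `infl`. -/
theorem tendstoInMeasure_sqrt_smul_tauBar_sub (hΘ : IsOpen Θ) (hf : IsDensityFamily f Θ)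
    (hθ₀ : θ₀ ∈ Θ) (hreg : DifferentiableInMeanAt f θ₀)
    (hXlaw : ∀ i, HasLaw (X i) (law f θ₀) P) (hXindep : iIndepFun X P)
    (hrep : HasLinearRepresentation P X f r est θ₀) :
    TendstoInMeasure P (fun (n : ℕ) ω =>
      √(n : ℝ) • tauBar f (fun i : Fin n => X i ω) (est n fun i => X i ω)
        - (√(n : ℝ))⁻¹ • ∑ k ∈ Finset.range n, infl f r θ₀ (X k ω)) atTop (fun _ => 0) := by
  set T : ℕ → Ω → Vec p := fun n ω => est n fun i => X i ω with hT
  set U : ℕ → Ω → Vec p := fun n ω => √(n : ℝ) • (T n ω - θ₀) with hU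
  set L := Matrix.toEuclideanCLM (𝕜 := ℝ) (matR f r θ₀)⁻¹ with hL
  set S : ℕ → Ω → Vec p := fun n ω => (√(n : ℝ))⁻¹ • ∑ k ∈ Finset.range n, r θ₀ (X k ω) with hS
  have hUb : BoundedInProb P U := boundedInProb_sqrt_smul_est_sub hXlaw hXindep hrep
  obtain ⟨h, hho, hh⟩ := exists_isLittleO_tau hf hθ₀ hreg hΘ
  have hrem := hUb.tendstoInMeasure_isLittleO hho
  suffices hcoord : ∀ i : Fin 2, TendstoInMeasure P (fun (n : ℕ) ω =>
      (√(n : ℝ) • tauBar f (fun i : Fin n => X i ω) (T n ω)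
        - (√(n : ℝ))⁻¹ • ∑ k ∈ Finset.range n, infl f r θ₀ (X k ω)) i) atTop (fun _ => 0) by
    refine tendstoInMeasure_zero_of_norm_le_add (hcoord 0) (hcoord 1) fun n ω => ?_
    rw [EuclideanSpace.norm_eq, Fin.sum_univ_two]
    refine Real.sqrt_le_iff.2 ⟨by positivity, ?_⟩
    nlinarith [mul_nonneg (norm_nonneg ((√(n : ℝ) • tauBar f (fun i : Fin n => X i ω) (T n ω)
        - (√(n : ℝ))⁻¹ • ∑ k ∈ Finset.range n, infl f r θ₀ (X k ω)) 0))
      (norm_nonneg ((√(n : ℝ) • tauBar f (fun i : Fin n => X i ω) (T n ω)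
        - (√(n : ℝ))⁻¹ • ∑ k ∈ Finset.range n, infl f r θ₀ (X k ω)) 1))]
  intro i
  set D : ℕ → Ω → Vec p := fun n ω =>
    (n : ℝ)⁻¹ • ∑ k ∈ Finset.range n, tauGrad f θ₀ i (X k ω) with hD
  -- The mean gradient converges to minus the row of G, by the law of large numbers and the
  -- differentiated identity.
  have hDlim : TendstoInMeasure P (fun n ω => D n ω + rowG f θ₀ i) atTop (fun _ => 0) := by
    have h1 := tendstoInMeasure_average_of_hasLaw hXlaw hXindep (integrable_tauGrad hf hθ₀ hreg i)
    rw [tendstoInMeasure_iff_norm] at h1 ⊢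
    rw [eq_neg_of_add_eq_zero_left (integral_tauGrad hf hθ₀ hreg hΘ i)] at h1
    simpa [rowG, hD] using h1
  have hUD : TendstoInMeasure P (fun n ω => inner ℝ (U n ω) (D n ω + rowG f θ₀ i)) atTop
      (fun _ => 0) :=
    tendstoInMeasure_zero_of_norm_le_mul hDlim hUb fun n ω => by
      rw [mul_comm]; exact norm_inner_le_norm _ _
  have hUS : TendstoInMeasure P (fun n ω => inner ℝ (rowG f θ₀ i) (L (S n ω) - U n ω)) atTop
      (fun _ => 0) := by
    have hconst : BoundedInProb P fun (_ : ℕ) (_ : Ω) => rowG f θ₀ i := fun η _ =>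
      ⟨‖rowG f θ₀ i‖ + 1, by positivity, Eventually.of_forall fun n => by simp [not_le.2 one_pos]⟩
    refine tendstoInMeasure_zero_of_norm_le_mul hrep.tendsto hconst fun n ω => ?_
    rw [mul_comm, norm_sub_rev]
    exact norm_inner_le_norm _ _
  set R : ℕ → Ω → ℝ := fun n ω => √(n : ℝ) * ((n : ℝ)⁻¹ * ∑ k ∈ Finset.range n,
    (tau f (T n ω) (X k ω) i - tau f θ₀ (X k ω) i
      - inner ℝ (T n ω - θ₀) (tauGrad f θ₀ i (X k ω)))) with hR
  have hRlim : TendstoInMeasure P R atTop (fun _ => 0) := by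
    refine tendstoInMeasure_zero_of_norm_le hrem fun n ω => ?_
    rw [hR, norm_mul, norm_mul, norm_mul]
    gcongr
    refine le_trans ?_ (le_abs_self _)
    have hsum : ‖∑ k ∈ Finset.range n, (tau f (T n ω) (X k ω) i - tau f θ₀ (X k ω) i
        - inner ℝ (T n ω - θ₀) (tauGrad f θ₀ i (X k ω)))‖ ≤ n * h (T n ω) := by
      refine (norm_sum_le_of_le _ fun k _ => hh (T n ω) i (X k ω)).trans (le_of_eq ?_)
      simp
    have h0 : 0 ≤ h (T n ω) := (abs_nonneg _).trans (hh (T n ω) i 0)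
    rw [norm_inv, RCLike.norm_natCast]
    rcases Nat.eq_zero_or_pos n with rfl | hn
    · simpa using h0
    · have hn' : (0 : ℝ) < n := by exact_mod_cast hn
      rwa [inv_mul_le_iff₀ hn']
  -- With g the row of G, the error is exactly R + ⟨U, D + g⟩ + ⟨g, L S - U⟩: the terms ⟨U, D⟩ and
  -- ⟨U, g⟩ cancel.
  refine (tendstoInMeasure_zero_add (tendstoInMeasure_zero_add hRlim hUD) hUS).congr_left
    fun n => Eventually.of_forall fun ω => ?_
  have hsn : (√(n : ℝ))⁻¹ = √(n : ℝ) * (n : ℝ)⁻¹ := by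
    rw [← div_eq_mul_inv, Real.sqrt_div_self]
  have hτ : tauBar f (fun i : Fin n => X i ω) (T n ω) i
      = (n : ℝ)⁻¹ * ∑ k ∈ Finset.range n, tau f (T n ω) (X k ω) i := by
    rw [tauBar, Finset.sum_range]
    simp
  simp only [PiLp.sub_apply, PiLp.smul_apply, smul_eq_mul, hτ, WithLp.ofLp_sum, Finset.sum_apply,
    infl_apply, hR, hU, hS, hD, Finset.sum_sub_distrib, inner_add_right, inner_sub_right,
    inner_smul_right, real_inner_smul_left, inner_sum, map_smul, map_sum, hsn, ← hL]
  rw [real_inner_comm (rowG f θ₀ i) (T n ω - θ₀), inner_sub_right, ← Finset.mul_sum]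
  ring

/-- Under the null hypothesis, `√n τ̄ₙ(θ̂ₙ)` is asymptotically normal with covariance `Σ_{θ₀}`. -/
theorem tendstoInDistribution_sqrt_smul_tauBar (hΘ : IsOpen Θ) (hf : IsDensityFamily f Θ)
    (hθ₀ : θ₀ ∈ Θ) (hreg : DifferentiableInMeanAt f θ₀)
    (hXlaw : ∀ i, HasLaw (X i) (law f θ₀) P) (hXindep : iIndepFun X P)
    (hest : ∀ n, Measurable (est n)) (hrep : HasLinearRepresentation P X f r est θ₀) :
    TendstoInDistribution (fun (n : ℕ) ω =>
      √(n : ℝ) • tauBar f (fun i : Fin n => X i ω) (est n fun i => X i ω)) atTop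
      (id : Vec 2 → Vec 2) (fun _ => P) (multivariateGaussian 0 (sigma f r θ₀)) := by
  have hclt := tendstoInDistribution_of_hasLaw hXlaw hXindep (memLp_infl hf hθ₀ hrep.memLp)
    (integral_infl hf hθ₀ hrep.memLp hrep.integral_eq_zero)
    (sigma_eq_integral hf hθ₀ hreg hrep.memLp hrep.posDef)
  refine tendstoInDistribution_of_tendstoInMeasure_sub _ _ hclt
    (tendstoInMeasure_sqrt_smul_tauBar_sub hΘ hf hθ₀ hreg hXlaw hXindep hrep) fun n => ?_
  have hT : AEMeasurable (fun ω => est n fun i => X i ω) P :=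
    (hest n).comp_aemeasurable (aemeasurable_pi_lambda _ fun i => (hXlaw i).aemeasurable)
  have hk (k : Fin n) : AEMeasurable (fun ω => tau f (est n fun i => X i ω) (X k ω)) P :=
    hf.aemeasurable_tau_comp hT (hXlaw k).aemeasurable
  have hsum : AEMeasurable (fun ω => ∑ k : Fin n, tau f (est n fun i => X i ω) (X k ω)) P :=
    Finset.aemeasurable_fun_sum Finset.univ fun k _ => hk k
  exact (hsum.fun_const_smul (n : ℝ)⁻¹).fun_const_smul √(n : ℝ)

end Main

end TrigGOF

theorem mainTheorem1 {Ω : Type*} [MeasurableSpace Ω] (P : Measure Ω) [IsProbabilityMeasure P]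
    {p : ℕ} (Θ : Set (Vec p)) (hΘ : IsOpen Θ)
    (f : Vec p → ℝ → ℝ) (hf : IsDensityFamily f Θ)
    (r : Vec p → ℝ → Vec p)
    (θ₀ : Vec p) (hθ₀ : θ₀ ∈ Θ) (hreg : DifferentiableInMeanAt f θ₀)
    (hmeas : ∀ i j, Measurable fun θ => sigma f r θ i j)
    (hcont : ContinuousAt (fun θ => sigma f r θ) θ₀)
    (hdet : (sigma f r θ₀).det ≠ 0)
    (X : ℕ → Ω → ℝ) (hXlaw : ∀ i, HasLaw (X i) (law f θ₀) P) (hXindep : iIndepFun X P)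
    (est : (n : ℕ) → (Fin n → ℝ) → Vec p) (hest : ∀ n, Measurable (est n))
    (hrep : HasLinearRepresentation P X f r est θ₀) :
    TendstoInDistribution
        (fun (n : ℕ) ω => normalized f r (fun i : Fin n => X i ω) (est n fun i => X i ω))
        atTop (id : Vec 2 → Vec 2) (fun _ => P) (multivariateGaussian 0 1) ∧
      TendstoInDistribution
        (fun (n : ℕ) ω => testStat f r (fun i : Fin n => X i ω) (est n fun i => X i ω))
        atTop (id : ℝ → ℝ) (fun _ => P) (chiSquared 2) := by
  have hV := tendstoInDistribution_sqrt_smul_tauBar hΘ hf hθ₀ hreg hXlaw hXindep hest hrep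
  have hU := boundedInProb_sqrt_smul_est_sub hXlaw hXindep hrep
  have hT : ∀ n, AEMeasurable (fun ω => est n fun i => X i ω) P := fun n =>
    (hest n).comp_aemeasurable (aemeasurable_pi_lambda _ fun i => (hXlaw i).aemeasurable)
  -- As a second moment matrix Σ at `θ₀` is positive semidefinite, so nonsingularity makes it
  -- positive definite.
  have hpsd : (sigma f r θ₀).PosSemidef :=
    (posSemidef_of_integral_mul (memLp_infl hf hθ₀ hrep.memLp)
      (sigma_eq_integral hf hθ₀ hreg hrep.memLp hrep.posDef)).1
  constructor
  · have hc : ContinuousAt (fun θ => (fun i j => invSqrt (sigma f r θ) i j : Fin 2 → Fin 2 → ℝ))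
        θ₀ := continuousAt_invSqrt hcont (sigma_isSymm f r) hpsd hdet
    have hm : Measurable fun θ => (fun i j => invSqrt (sigma f r θ) i j : Fin 2 → Fin 2 → ℝ) :=
      measurable_pi_iff.2 fun i => measurable_pi_iff.2 fun j =>
        measurable_invSqrt hmeas (sigma_isSymm f r) i j
    have hg : Continuous fun z : Vec 2 × (Fin 2 → Fin 2 → ℝ) =>
        (WithLp.toLp 2 fun i => ∑ j, z.2 i j * z.1 j : Vec 2) := by fun_prop
    have hlim := hV.continuous_comp_prodMk_of_tendstoInMeasure_const hg
      (hU.tendstoInMeasure_comp hc) fun n => hm.comp_aemeasurable (hT n)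
    have hlim' := TendstoInDistribution.of_map_eq hlim
      (P'' := multivariateGaussian 0 (1 : Matrix (Fin 2) (Fin 2) ℝ)) (Z' := id) aemeasurable_id ?_
    · convert! hlim' using 3 with n ω
      rw [normalized, ← map_smul]
      rfl
    · rw [Measure.map_id]
      exact map_multivariateGaussian_invSqrt hpsd hdet
  · have hc : ContinuousAt (fun θ => (fun i j => (sigma f r θ)⁻¹ i j : Fin 2 → Fin 2 → ℝ)) θ₀ :=
      continuousAt_inv_fin_two hcont hdet
    have hm : Measurable fun θ => (fun i j => (sigma f r θ)⁻¹ i j : Fin 2 → Fin 2 → ℝ) :=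
      measurable_pi_iff.2 fun i => measurable_pi_iff.2 fun j => measurable_inv_fin_two hmeas i j
    have hg : Continuous fun z : Vec 2 × (Fin 2 → Fin 2 → ℝ) =>
        ∑ i, z.1 i * ∑ j, z.2 i j * z.1 j := by fun_prop
    have hlim := hV.continuous_comp_prodMk_of_tendstoInMeasure_const hg
      (hU.tendstoInMeasure_comp hc) fun n => hm.comp_aemeasurable (hT n)
    have hlim' := TendstoInDistribution.of_map_eq hlim
      (P'' := chiSquared 2) (Z' := id) aemeasurable_id ?_
    · convert! hlim' using 3 with n ω
      rw [testStat]
      have hs : (n : ℝ) = √(n : ℝ) * √(n : ℝ) := (Real.mul_self_sqrt n.cast_nonneg).symm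
      simp only [dotProduct, Matrix.mulVec, Fin.sum_univ_two, PiLp.smul_apply, smul_eq_mul]
      conv_lhs => rw [hs]
      ring
    · rw [Measure.map_id]
      exact map_multivariateGaussian_dotProduct_inv hpsd hdet
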